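/- **Setting.** A star schema has $n\ge 1$ dimension tables $D_1,\dots,D_n$, where $D_i$ has a key attribute $K_i$ and further attributes $A_i^1,\dots,A_i^{d_i}$, and a fact table $F$ over $\mathbb K=\{K_1,\dots,K_n\}$ and numeric measures $M_1,\dots,M_p$. The functional dependencies are $FD=\{K_i\to A_i^j\}\cup\{\mathbb K\to M_k\}$. Tables are finite and may have missing values, but each tuple of $D_i$ is defined on $K_i$ and on some $A_i^j$, and each tuple of $F$ on $\mathbb K$ and on some measure; neither $FD$ nor referential constraints need hold. The star-table $T$ is the set of all tuples of all these tables, and $adom(A)$ is the set of values of $A$ occurring in $T$. For a finite set $R$ of tuples, $\mathsf{True}(R)$ is the set of (nonempty) tuples inferred from $R$ by passing to sub-tuples and applying dependencies of $FD$; a true tuple $t$ is conflicting if for some $X\to A$ in $FD$ with $XA\subseteq sch(t)$ another true tuple has the same $X$-value as $t$ and a different $A$-value; $\mathsf{Cons}(R)$ is the set of true non-conflicting tuples; $R\models FD$ means that there are no conflicting tuples. A repair of $T$ is a finite $R$ with $\mathsf{Cons}(T)\subseteq\mathsf{True}(R)\subseteq\mathsf{True}(T)$, $R\models FD$ and $\mathsf{True}(R)$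 maximal among the $\mathsf{True}(R')$ for such $R'$. **Queries.** Let $\mathcal{AQ}$ be `select` $aggr(M_i)$ `from` $T$ `where` $\Gamma$, with $aggr\in\{min,max,sum,count\}$ and $\Gamma$ independent: $\Gamma$ is a Boolean combination of comparisons $A\,\theta\,a$, $A\,\theta\,A'$, and is equivalent, over the constants of $T$, to a conjunction of conditions $\Gamma(A)$, $A\in sch(\Gamma)$, where $\Gamma(A)$ involves only $A$. The answer in a repair $R$ is the aggregate of the $M_i$-values of the tuples of $\mathsf{True}(R)$ with schema $\mathbb K\cup\{M_i\}\cup sch(\Gamma)$ that satisfy $\Gamma$. If in some repair there is no such tuple, then $\mathsf{C\_ans}(\mathcal{AQ})$ is NULL for $aggr\neq count$ and $0$, i.e. $[0,0]$, for $count$; otherwise $\mathsf{C\_ans}(\mathcal{AQ})=[glb,lub]$, where $glb$ and $lub$ are the least and the greatest answer over all repairs. The strongly consistent answer $\mathsf{C\_ans}^*(\mathcal{AQ})$ is the aggregate of $M_i$ over the set of all tuples over $\mathbb K\cup\{M_i\}$ that belong, in every repair, to the answer to `select` $\mathbb K,M_i$ `where` $\Gamma$ (NULL if this set is empty and $aggr\ne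 count$). **Algorithm.** $m\_Chase(T)$ is an m-table (a set of m-tuples $\sigma$, each assigning a possibly empty set of values $\sigma(A)$ to every attribute $A$) obtained from $T$, with each tuple read as an m-tuple of singletons, as follows. As long as the m-table changes, take $X\to A$ in $FD$ and $\sigma,\sigma'$ that are defined on $X$ and share an $X$-value, at least one of them being defined on $A$; replace both $\sigma(A)$ and $\sigma'(A)$ with $\sigma(A)\cup\sigma'(A)$, keeping only the larger one of the two resulting m-tuples if they are comparable. Let $\Sigma$ be the set of $\sigma\in m\_Chase(T)$ that are defined on $\mathbb K\cup\{M_i\}\cup sch(\Gamma)$ and have a tuple over $sch(\Gamma)$ satisfying $\Gamma$, and $\Sigma^+$ the set of $\sigma\in\Sigma$ all of whose tuples over $sch(\Gamma)$ satisfy $\Gamma$. For $\sigma\in\Sigma$ let $min_\sigma$, $max_\sigma$ be the least and greatest value of $\sigma(M_i)$ (satisfying $\Gamma(M_i)$ if $M_i\in sch(\Gamma)$). The algorithm scans $m\_Chase(T)$ in any order, with $min\_ans,max\_ans,ans^*$ initialised to $0$ for $count$ and to a dummy value that is neutral for all operations otherwise. * For $\sigma\in\Sigma^+$: it sets $change:=true$.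 If $aggr=count$ it adds $1$ to $min\_ans$ and to $max\_ans$; otherwise it sets $min\_ans:=aggr(min_\sigma,min\_ans)$ and $max\_ans:=aggr(max_\sigma,max\_ans)$. If $\sigma(M_i)=\{m_0\}$ is a singleton it sets $ans^*:=aggr(ans^*,m_0)$ (adds $1$ for $count$). * For $\sigma\in\Sigma\setminus\Sigma^+$: it sets $min\_ans:=\min(min_\sigma,min\_ans)$ if $aggr=min$; $max\_ans:=\max(max_\sigma,max\_ans)$ if $aggr=max$; adds $1$ to $max\_ans$ if $aggr=count$; and if $aggr=sum$ adds $min_\sigma$ to $min\_ans$ when $min_\sigma<0$ and $max_\sigma$ to $max\_ans$ when $max_\sigma>0$. If $change$ is true at the end, it returns $([min\_ans,max\_ans],ans^*)$, a dummy $ans^*$ being read as NULL; otherwise it returns (NULL, NULL), or $([0,0],0)$ for $count$. **Proposition.** The computation of $m\_Chase(T)$ has an output, and for every output and every scanning order: * If $aggr$ is $min$, $max$ or $count$, the interval (or NULL) returned by the algorithm is $\mathsf{C\_ans}(\mathcal{AQ})$. * If $aggr=sum$ and $\mathsf{C\_ans}(\mathcal{AQ})=[glb,lub]$, then the algorithm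 returns an interval $[min\_ans,max\_ans]$ with $min\_ans\le glb$ and $max\_ans\ge lub$. Moreover, if $aggr=sum$ and $m\ge 0$ for every $m\in adom(M_i)$, then the interval (or NULL) returned is exactly $\mathsf{C\_ans}(\mathcal{AQ})$. * For every aggregate operator, the value $ans^*$ returned (NULL included) is $\mathsf{C\_ans}^*(\mathcal{AQ})$. -/

import Mathlib

/-! Star schemas, data warehouses with inconsistent or missing data, multi-valued chase,
repairs, consistent answers to analytic queries, and the algorithm that computes them. -/

namespace StarDW

/-- A star schema: `n` dimension tables (the `i`-th one with a key and `d i` further attributes)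
and a fact table over the `n` keys and `p` measures.  Measures are numeric. -/
structure StarSchema where
  n : ℕ
  n_pos : 0 < n
  d : Fin n → ℕ
  p : ℕ
  keyDom : Fin n → Type
  dimDom : (i : Fin n) → Fin (d i) → Type

/-- The universe of attributes. -/
inductive Attr (S : StarSchema) : Type
  | key (i : Fin S.n) : Attr S
  | dim (i : Fin S.n) (j : Fin (S.d i)) : Attr S
  | meas (k : Fin S.p) : Attr S

/-- The domain of an attribute. -/
@[reducible] def Attr.dom {S : StarSchema} : Attr S → Type
  | .key i => S.keyDom i
  | .dim i j => S.dimDom i j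
  | .meas _ => ℝ

/-- The set of all dimension keys. -/
def keys (S : StarSchema) : Set (Attr S) := Set.range Attr.key

/-- A tuple over a part of the universe; `none` means that the tuple is not defined there. -/
def Tup (S : StarSchema) : Type := (A : Attr S) → Option A.dom

namespace Tup

/-- The schema of a tuple. -/
def sch {S : StarSchema} (t : Tup S) : Set (Attr S) := {A | t A ≠ none}

open Classical in
/-- The restriction `t.X`. -/
noncomputable def restrict {S : StarSchema} (t : Tup S) (X : Set (Attr S)) : Tup S :=
  fun A => if A ∈ X then t A else none

/-- `q` is a sub-tuple of `t`. -/
def Sub {S : StarSchema} (q t : Tup S) : Prop := ∀ A ∈ q.sch, q A = t A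

end Tup

/-- A functional dependency `lhs → rhs`. -/
structure Dep (S : StarSchema) where
  lhs : Set (Attr S)
  rhs : Attr S

/-- The functional dependencies of a star schema. -/
def starFD (S : StarSchema) : Set (Dep S) :=
  {f | (∃ i j, f = ⟨{Attr.key i}, Attr.dim i j⟩) ∨ (∃ k, f = ⟨keys S, Attr.meas k⟩)}

/-- A data warehouse over a star schema: finite tables whose tuples may have missing values, but
each dimension tuple has its key and some other value, and each fact has all keys and some
measure value.  No dependency and no referential constraint is required. -/
structure Warehouse (S : StarSchema) where
  D : Fin S.n → Finset (Tup S)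
  F : Finset (Tup S)
  D_sch : ∀ i, ∀ t ∈ D i, t.sch ⊆ {Attr.key i} ∪ Set.range (Attr.dim i)
  D_key : ∀ i, ∀ t ∈ D i, Attr.key i ∈ t.sch
  D_val : ∀ i, ∀ t ∈ D i, ∃ j, Attr.dim i j ∈ t.sch
  F_sch : ∀ t ∈ F, t.sch ⊆ keys S ∪ Set.range Attr.meas
  F_key : ∀ t ∈ F, keys S ⊆ t.sch
  F_val : ∀ t ∈ F, ∃ k, Attr.meas k ∈ t.sch

/-- The star-table of a warehouse: all its tuples, collected in one table over the universe. -/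
def Warehouse.table {S : StarSchema} (W : Warehouse S) : Set (Tup S) :=
  {t | (∃ i, t ∈ W.D i) ∨ t ∈ W.F}

/-- The active domain of an attribute in a table. -/
def adom {S : StarSchema} (T : Set (Tup S)) (A : Attr S) : Set A.dom :=
  {a | ∃ t ∈ T, t A = some a}

/-- All tuples over the schema `X` that can be built up from the constants of `T`. -/
def discourse {S : StarSchema} (T : Set (Tup S)) (X : Set (Attr S)) : Set (Tup S) :=
  {t | t.sch = X ∧ ∀ A a, t A = some a → a ∈ adom T A}

/-! ### True, conflicting and consistent tuples; repairs -/

/-- The true tuples of `T`: all (nonempty) tuples that are inferred from `T`, that is, by passing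
to sub-tuples and by applying a dependency `X → A`: if `t` and `s` agree on `X` and `s` is defined
over `A`, then the tuple that has the `A`-value of `s` and agrees with `t` elsewhere is true. -/
inductive IsTrue {S : StarSchema} (T : Set (Tup S)) : Tup S → Prop
  | base {t : Tup S} : t ∈ T → IsTrue T t
  | sub {q t : Tup S} : IsTrue T t → q.sch.Nonempty → q.Sub t → IsTrue T q
  | infer {t s u : Tup S} (f : Dep S) : f ∈ starFD S → IsTrue T t → IsTrue T s →
      f.lhs ⊆ t.sch → (∀ B ∈ f.lhs, t B = s B) → f.rhs ∈ s.sch →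
      u f.rhs = s f.rhs → (∀ B, B ≠ f.rhs → u B = t B) → IsTrue T u

/-- The set of true tuples. -/
def trueTuples {S : StarSchema} (T : Set (Tup S)) : Set (Tup S) := {t | IsTrue T t}

/-- The conflicting tuples: true tuples `t` such that for some dependency `X → A` with
`XA ⊆ sch t` another true tuple has the same `X`-value and a different `A`-value. -/
def conflTuples {S : StarSchema} (T : Set (Tup S)) : Set (Tup S) :=
  {t | t ∈ trueTuples T ∧ ∃ f ∈ starFD S, f.lhs ⊆ t.sch ∧ f.rhs ∈ t.sch ∧
    ∃ s ∈ trueTuples T, (∀ B ∈ f.lhs, s B = t B) ∧ f.rhs ∈ s.sch ∧ s f.rhs ≠ t f.rhs}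

/-- The consistent tuples: true and not conflicting. -/
def consTuples {S : StarSchema} (T : Set (Tup S)) : Set (Tup S) :=
  trueTuples T \ conflTuples T

/-- `T` satisfies the dependencies: no tuple is conflicting. -/
def Satisfies {S : StarSchema} (T : Set (Tup S)) : Prop := conflTuples T = ∅

/-- The first two requirements on a repair `R` of `T`. -/
structure PreRepair {S : StarSchema} (T R : Set (Tup S)) : Prop where
  finite : R.Finite
  cons_sub : consTuples T ⊆ trueTuples R
  sub_true : trueTuples R ⊆ trueTuples T
  sat : Satisfies R

/-- `R` is a repair of `T`. -/
def IsRepair {S : StarSchema} (T R : Set (Tup S)) : Prop :=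
  PreRepair T R ∧
    ∀ R', PreRepair T R' → trueTuples R ⊆ trueTuples R' → trueTuples R = trueTuples R'

/-! ### Selection conditions -/

/-- Selection conditions, for arbitrary comparison predicates `θ`. -/
inductive Cond (S : StarSchema) : Type
  | cmpConst (A : Attr S) (θ : A.dom → A.dom → Prop) (a : A.dom) : Cond S
  | cmpAttr (A B : Attr S) (θ : A.dom → B.dom → Prop) : Cond S
  | neg (Γ : Cond S) : Cond S
  | disj (Γ₁ Γ₂ : Cond S) : Cond S
  | conj (Γ₁ Γ₂ : Cond S) : Cond S

namespace Cond

/-- The attributes that occur in a condition. -/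
def sch {S : StarSchema} : Cond S → Set (Attr S)
  | cmpConst A _ _ => {A}
  | cmpAttr A B _ => {A, B}
  | neg Γ => Γ.sch
  | disj Γ₁ Γ₂ => Γ₁.sch ∪ Γ₂.sch
  | conj Γ₁ Γ₂ => Γ₁.sch ∪ Γ₂.sch

/-- Truth of a condition at a tuple (only used where the tuple is defined over the schema of the
condition). -/
def Holds {S : StarSchema} : Cond S → Tup S → Prop
  | cmpConst A θ a, t => ∃ v, t A = some v ∧ θ v a
  | cmpAttr A B θ, t => ∃ v w, t A = some v ∧ t B = some w ∧ θ v w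
  | neg Γ, t => ¬ Γ.Holds t
  | disj Γ₁ Γ₂, t => Γ₁.Holds t ∨ Γ₂.Holds t
  | conj Γ₁ Γ₂, t => Γ₁.Holds t ∧ Γ₂.Holds t

/-- `Sat(Γ)`: the tuples over the schema of `Γ`, built from the constants of `T`, at which `Γ`
holds. -/
def Sat {S : StarSchema} (T : Set (Tup S)) (Γ : Cond S) : Set (Tup S) :=
  {t | t ∈ discourse T Γ.sch ∧ Γ.Holds t}

/-- `Γ` is independent: it is equivalent to the conjunction of the conditions `part A`, for `A` in
the schema of `Γ`, where `part A` involves only the attribute `A`. -/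
structure IndependentVia {S : StarSchema} (T : Set (Tup S)) (Γ : Cond S)
    (part : Attr S → Cond S) : Prop where
  sch_part : ∀ A ∈ Γ.sch, (part A).sch = {A}
  sat_iff : ∀ t ∈ discourse T Γ.sch,
    t ∈ Γ.Sat T ↔ ∀ A ∈ Γ.sch, t.restrict {A} ∈ (part A).Sat T

end Cond

/-! ### Standard queries and their consistent answers -/

/-- The answer to `select X from R where Γ` (conditions are evaluated over the constants of
`T`). -/
def ans {S : StarSchema} (T : Set (Tup S)) (X : Set (Attr S)) (Γ : Cond S) (R : Set (Tup S)) :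
    Set (Tup S) :=
  {x | x.sch = X ∧ ∃ t ∈ trueTuples R,
    t.sch = X ∪ Γ.sch ∧ t.restrict X = x ∧ t.restrict Γ.sch ∈ Γ.Sat T}

/-- The consistent answer to `select X from T where Γ`. -/
def consAns {S : StarSchema} (T : Set (Tup S)) (X : Set (Attr S)) (Γ : Cond S) : Set (Tup S) :=
  {x | ∀ R, IsRepair T R → x ∈ ans T X Γ R}

/-! ### Analytic queries without group-by -/

/-- The aggregate operators. -/
inductive Aggr : Type
  | min
  | max
  | sum
  | count

/-- The analytic query `select aggr(M) from T where Γ`. -/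
structure AnalyticQuery (S : StarSchema) where
  aggr : Aggr
  M : Fin S.p
  Γ : Cond S

namespace AnalyticQuery

/-- The schema of the associated query `select K, M from T where Γ`: keys, the aggregated measure
and the attributes of `Γ`. -/
def sch {S : StarSchema} (q : AnalyticQuery S) : Set (Attr S) :=
  keys S ∪ {Attr.meas q.M} ∪ q.Γ.sch

end AnalyticQuery

open Classical in
/-- The aggregate of the `M`-values of a finite set `Q` of tuples that are defined over `M`, every
tuple contributing its value.  Except for `count`, it is `NULL` (`none`) if `Q` is empty. -/
noncomputable def aggregate {S : StarSchema} (op : Aggr) (M : Fin S.p) (Q : Set (Tup S)) :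
    Option ℝ :=
  match op with
  | .count => some (Q.ncard : ℝ)
  | .min => if Q = ∅ then none else some (sInf {v : ℝ | ∃ t ∈ Q, t (Attr.meas M) = some v})
  | .max => if Q = ∅ then none else some (sSup {v : ℝ | ∃ t ∈ Q, t (Attr.meas M) = some v})
  | .sum => if Q = ∅ then none else some (∑ᶠ t ∈ Q, Option.getD (α := ℝ) (t (Attr.meas M)) 0)

namespace AnalyticQuery

/-- The true tuples of `R` over the schema of the query that satisfy the condition. -/
def selected {S : StarSchema} (q : AnalyticQuery S) (T R : Set (Tup S)) : Set (Tup S) :=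
  {t | t ∈ trueTuples R ∧ t.sch = q.sch ∧ t.restrict q.Γ.sch ∈ q.Γ.Sat T}

/-- The answer to the analytic query in `R`. -/
noncomputable def answer {S : StarSchema} (q : AnalyticQuery S) (T R : Set (Tup S)) : Option ℝ :=
  aggregate q.aggr q.M (q.selected T R)

/-- `c` is the consistent answer to the analytic query: `none` stands for `NULL` and
`some (glb, lub)` for the interval `[glb, lub]`, the answer `0` for `count` being `[0, 0]`. -/
def IsConsistentAnswer {S : StarSchema} (q : AnalyticQuery S) (T : Set (Tup S))
    (c : Option (ℝ × ℝ)) : Prop :=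
  ((∃ R, IsRepair T R ∧ q.selected T R = ∅) →
    (q.aggr ≠ .count → c = none) ∧ (q.aggr = .count → c = some (0, 0))) ∧
  ((∀ R, IsRepair T R → (q.selected T R).Nonempty) →
    ∃ glb lub : ℝ, c = some (glb, lub) ∧
      (∀ R, IsRepair T R → ∃ d ∈ Set.Icc glb lub, q.answer T R = some d) ∧
      (∃ R₁, IsRepair T R₁ ∧ q.answer T R₁ = some glb) ∧
      (∃ R₂, IsRepair T R₂ ∧ q.answer T R₂ = some lub))

/-- The strongly consistent answer: the aggregate over the consistent answer to
`select K, M from T where Γ`. -/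
noncomputable def strongAnswer {S : StarSchema} (q : AnalyticQuery S) (T : Set (Tup S)) :
    Option ℝ :=
  aggregate q.aggr q.M (consAns T (keys S ∪ {Attr.meas q.M}) q.Γ)

end AnalyticQuery

/-! ### Multi-valued tuples and the m-Chase -/

/-- A multi-valued tuple. -/
def MTup (S : StarSchema) : Type := (A : Attr S) → Set A.dom

namespace MTup

/-- The schema of an m-tuple. -/
def sch {S : StarSchema} (σ : MTup S) : Set (Attr S) := {A | (σ A).Nonempty}

/-- The restriction `σ(X)`. -/
def restrict {S : StarSchema} (σ : MTup S) (X : Set (Attr S)) : MTup S :=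
  fun A => {a | a ∈ σ A ∧ A ∈ X}

/-- The component-wise union. -/
def union {S : StarSchema} (σ τ : MTup S) : MTup S := fun A => σ A ∪ τ A

/-- The component-wise inclusion. -/
def Le {S : StarSchema} (σ τ : MTup S) : Prop := ∀ A, σ A ⊆ τ A

/-- The tuples of an m-tuple. -/
def tuples {S : StarSchema} (σ : MTup S) : Set (Tup S) :=
  {t | t.sch = σ.sch ∧ ∀ A a, t A = some a → a ∈ σ A}

/-- A tuple, seen as an m-tuple. -/
def ofTup {S : StarSchema} (t : Tup S) : MTup S := fun A => {a | t A = some a}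

end MTup

open Classical in
/-- The m-table that the m-Chase rule for the attribute `A` makes of `Σ` at `σ` and `σ'`: with
`σ₁ = σ ⊔ σ'(A)` and `σ₁' = σ' ⊔ σ(A)`, the m-tuples `σ` and `σ'` are replaced with `σ₁` and `σ₁'`,
but only the larger one of them is kept if they are comparable. -/
noncomputable def mChaseRule {S : StarSchema} (Sig : Set (MTup S)) (σ σ' : MTup S) (A : Attr S) :
    Set (MTup S) :=
  let σ₁ := σ.union (σ'.restrict {A})
  let σ₁' := σ'.union (σ.restrict {A})
  if σ₁.Le σ₁' then (Sig \ {σ, σ'}) ∪ {σ₁'}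
  else if σ₁'.Le σ₁ then (Sig \ {σ, σ'}) ∪ {σ₁}
  else (Sig \ {σ, σ'}) ∪ {σ₁, σ₁'}

/-- One transformation step of the m-Chase: the rule is applied, for some dependency `X → A`, to
two m-tuples that are defined over `X` and share an `X`-value, at least one of them being defined
over `A`, and the m-table changes. -/
def MChaseStep {S : StarSchema} (Sig Sig' : Set (MTup S)) : Prop :=
  ∃ σ ∈ Sig, ∃ σ' ∈ Sig, ∃ f ∈ starFD S,
    f.lhs ⊆ σ.sch ∧ f.lhs ⊆ σ'.sch ∧ (f.rhs ∈ σ.sch ∨ f.rhs ∈ σ'.sch) ∧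
    ((σ.restrict f.lhs).tuples ∩ (σ'.restrict f.lhs).tuples).Nonempty ∧
    Sig' = mChaseRule Sig σ σ' f.rhs ∧ Sig' ≠ Sig

/-- `Sig` is an output of the m-Chase algorithm on `T`: it is reached from the m-table of all
tuples of `T` by transformation steps, in any order, and no further transformation is possible. -/
def IsMChase {S : StarSchema} (T : Set (Tup S)) (Sig : Set (MTup S)) : Prop :=
  Relation.ReflTransGen MChaseStep (MTup.ofTup '' T) Sig ∧ ∀ Sig', ¬ MChaseStep Sig Sig'

/-- The list `l` enumerates, in some order and without repetition, an output of the m-Chase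
algorithm on `T`. -/
def EnumeratesMChase {S : StarSchema} (T : Set (Tup S)) (l : List (MTup S)) : Prop :=
  l.Nodup ∧ IsMChase T {σ | σ ∈ l}

/-! ### The algorithm -/

/-- The variables of the procedure.  The value `none` is a dummy that is neutral for all operations
on values; once returned, it means `NULL`. -/
structure ProcState where
  change : Bool
  pmin : Option ℝ
  pmax : Option ℝ
  pans : Option ℝ

/-- The binary operation of an aggregate operator other than `count`; `none` is neutral. For `count`,
the second argument is just counted. -/
noncomputable def Aggr.add (op : Aggr) (acc : Option ℝ) (v : ℝ) : Option ℝ :=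
  match op, acc with
  | .count, none => some 1
  | .count, some x => some (x + 1)
  | _, none => some v
  | .min, some x => some (Min.min x v)
  | .max, some x => some (Max.max x v)
  | .sum, some x => some (x + v)

/-- The initial values. -/
noncomputable def procInit (op : Aggr) : ProcState :=
  match op with
  | .count => ⟨false, some 0, some 0, some 0⟩
  | _ => ⟨false, none, none, none⟩

namespace AnalyticQuery

variable {S : StarSchema} (q : AnalyticQuery S) (T : Set (Tup S)) (part : Attr S → Cond S)

/-- The test whether an m-tuple is taken into account: it is defined over the schema of the query
and one of its tuples satisfies the condition. -/
def Relevant (σ : MTup S) : Prop :=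
  q.sch ⊆ σ.sch ∧ ((σ.restrict q.Γ.sch).tuples ∩ q.Γ.Sat T).Nonempty

/-- The test whether all tuples of an m-tuple satisfy the condition. -/
def Certain (σ : MTup S) : Prop := (σ.restrict q.Γ.sch).tuples ⊆ q.Γ.Sat T

/-- The candidate `M`-values of an m-tuple: all its `M`-values, or only those that satisfy the
condition on `M` if `M` occurs in `Γ`. -/
def candidates (σ : MTup S) : Set ℝ :=
  {v | ∃ t ∈ (σ.restrict {Attr.meas q.M}).tuples, t (Attr.meas q.M) = some v ∧
    (Attr.meas q.M ∈ q.Γ.sch → t ∈ (part (Attr.meas q.M)).Sat T)}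

open Classical in
/-- The body of the loop, for the m-tuple `σ`.  (On a nonempty finite set of reals `sInf` and `sSup`
are the minimum and the maximum.) -/
noncomputable def procStep (st : ProcState) (σ : MTup S) : ProcState :=
  if q.Relevant T σ then
    let minσ := sInf (q.candidates T part σ)
    let maxσ := sSup (q.candidates T part σ)
    if q.Certain T σ then
      { change := true
        pmin := q.aggr.add st.pmin minσ
        pmax := q.aggr.add st.pmax maxσ
        pans := if h : ∃ m₀ : ℝ, σ (Attr.meas q.M) = {m₀} then q.aggr.add st.pans h.choose
          else st.pans }
    else
      match q.aggr with
      | .min => { st with pmin := Aggr.min.add st.pmin minσ }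
      | .max => { st with pmax := Aggr.max.add st.pmax maxσ }
      | .count => { st with pmax := Aggr.count.add st.pmax 1 }
      | .sum =>
        { st with
          pmin := if minσ < 0 then Aggr.sum.add st.pmin minσ else st.pmin
          pmax := if 0 < maxσ then Aggr.sum.add st.pmax maxσ else st.pmax }
  else st

/-- The procedure, scanning the m-tuples in the order of the list. -/
noncomputable def computeAggregate (l : List (MTup S)) : ProcState :=
  l.foldl (q.procStep T part) (procInit q.aggr)

/-- The algorithm: it returns the interval `[min_ans, max_ans]` (or `NULL`) and the value `ans*` (or
`NULL`).  (A dummy bound is never returned, as the bounds have been set when `change` is true.) -/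
noncomputable def algorithm (l : List (MTup S)) : Option (ℝ × ℝ) × Option ℝ :=
  let st := q.computeAggregate T part l
  if st.change = true then (Option.map₂ Prod.mk st.pmin st.pmax, st.pans)
  else
    match q.aggr with
    | .count => (some (0, 0), some 0)
    | _ => (none, none)

end AnalyticQuery

end StarDW

open StarDW

namespace StarDW

variable {S : StarSchema}

/-! ### Determining attributes -/

/-! Every dependency has the form `det A → A` with `A` not a key, so inference never changes keys
and never has to be iterated. For a tuple `s` of `T`, the saturated m-tuple `values T s` collects,
at each attribute `A`, the values attached by the tuples of `T` that agree with `s` on `det A`. The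
true tuples are exactly the nonempty tuples whose values all lie in one `values T s`
(`below_of_isTrue`, `isTrue_of_below`).

A conflict is the presence of two values in such a set, so repairing means picking one value for
each attribute and each value of its determining keys. These choices correspond to the repairs, up
to equality of true tuples (`isRepair_chosen`, `exists_choice_of_isRepair`). The m-Chase computes
the same data: its outputs consist of saturated m-tuples, among them one for every tuple having all
keys (`ChaseInv.eq_values`, `ChaseInv.values_mem`). It terminates because a weight decreases
(`tableWeight_lt`). Hence the tuples selected in the repair of a choice `c` match, injectively, the
scanned m-tuples at which `c` satisfies the condition (`selected_eq`), and answers in repairs and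
results of the scan become aggregates over one and the same list (`answer_eq`).

Certain m-tuples contribute in every repair and irrelevant ones in none. Independence allows values
to be picked attribute by attribute. A preference that looks only at the attribute and its value set
is automatically consistent across m-tuples that share a dimension key. This yields a choice
selecting all relevant m-tuples and a choice selecting only the certain ones, each with an extremal
measure value wherever it selects (`exists_favorable_choice`, `exists_adverse_choice`). They attain
the bounds for `min`, `max`, `count`, and for `sum` of nonnegative measures. For `sum` with mixed
signs the bounds may call for incompatible choices at a shared key, and only the termwise comparison
of `exists_ofList_low_le` and `exists_le_ofList_high` survives.

A tuple of the strongly consistent answer must appear under the adverse choice with least measures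
and under the one with greatest measures. So its m-tuple is certain and has a single measure value
(`consAns_eq`). -/

instance : Finite (Attr S) := by
  let f : Attr S → Fin S.n ⊕ (Σ i, Fin (S.d i)) ⊕ Fin S.p := fun A =>
    match A with
    | .key i => .inl i
    | .dim i j => .inr (.inl ⟨i, j⟩)
    | .meas k => .inr (.inr k)
  refine Finite.of_injective f ?_
  rintro (_ | _ | _) (_ | _ | _) h <;> simp [f] at h ⊢ <;> exact h

/-- The keys that determine an attribute. -/
def det : Attr S → Set (Attr S)
  | .key i => {.key i}
  | .dim i _ => {.key i}
  | .meas _ => keys S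

theorem det_subset_keys (A : Attr S) : det A ⊆ keys S := by
  cases A <;> simp [det, keys]

theorem det_of_mem_keys {A : Attr S} (h : A ∈ keys S) : det A = {A} := by
  obtain ⟨i, rfl⟩ := h
  rfl

/-- The normal form of dependencies used throughout: the right-hand side is never a key, and it
fixes the left-hand side. -/
theorem mem_starFD {X : Set (Attr S)} {A : Attr S} :
    (⟨X, A⟩ : Dep S) ∈ starFD S ↔ A ∉ keys S ∧ X = det A := by
  cases A <;> simp [starFD, keys, det]

theorem Tup.mem_sch {t : Tup S} {A : Attr S} : A ∈ t.sch ↔ ∃ a, t A = some a :=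
  Option.ne_none_iff_exists'

theorem Tup.mem_sch_congr {t s : Tup S} {A : Attr S} (h : t A = s A) :
    A ∈ t.sch ↔ A ∈ s.sch := by
  rw [Tup.mem_sch, Tup.mem_sch, h]

theorem Tup.ext {t s : Tup S} (h : ∀ A a, t A = some a ↔ s A = some a) : t = s :=
  funext fun A => Option.ext (h A)

theorem Tup.restrict_apply {t : Tup S} {X : Set (Attr S)} {A : Attr S} (h : A ∈ X) :
    t.restrict X A = t A := if_pos h

theorem Tup.restrict_eq_some {t : Tup S} {X : Set (Attr S)} {A : Attr S} {a : A.dom} :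
    t.restrict X A = some a ↔ A ∈ X ∧ t A = some a := by
  unfold Tup.restrict
  split_ifs with h <;> simp [h]

theorem Tup.sch_restrict {t : Tup S} {X : Set (Attr S)} : (t.restrict X).sch = X ∩ t.sch := by
  ext A
  simp [Tup.mem_sch, Tup.restrict_eq_some]

/-- Two tuples are defined and agree on the keys that determine `A`. -/
def Agree (A : Attr S) (s t : Tup S) : Prop := ∀ B ∈ det A, B ∈ s.sch ∧ s B = t B

theorem Agree.symm {A : Attr S} {s t : Tup S} (h : Agree A s t) : Agree A t s := fun B hB =>
  ⟨(Tup.mem_sch_congr (h B hB).2).1 (h B hB).1, (h B hB).2.symm⟩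

theorem Agree.trans {A : Attr S} {s t u : Tup S} (h : Agree A s t) (h' : Agree A t u) :
    Agree A s u := fun B hB => ⟨(h B hB).1, (h B hB).2.trans (h' B hB).2⟩

/-- The m-tuple of all values that tuples of `T` attach to the keys of `s`. -/
def values (T : Set (Tup S)) (s : Tup S) : MTup S :=
  fun A => {a | ∃ t ∈ T, Agree A t s ∧ t A = some a}

theorem values_congr (T : Set (Tup S)) {A : Attr S} {s s' : Tup S} (h : Agree A s s') :
    values T s A = values T s' A := by
  ext a
  exact ⟨fun ⟨t, ht, hts, hta⟩ => ⟨t, ht, hts.trans h, hta⟩,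
    fun ⟨t, ht, hts, hta⟩ => ⟨t, ht, hts.trans h.symm, hta⟩⟩

/-- A key determines only itself, so saturation adds nothing at keys. -/
theorem eq_of_mem_values_key {T : Set (Tup S)} {A : Attr S} {s : Tup S} {a : A.dom}
    (hA : A ∈ keys S) (h : a ∈ values T s A) : s A = some a := by
  obtain ⟨t, -, hts, hta⟩ := h
  rw [← (hts A (by rw [det_of_mem_keys hA]; rfl)).2, hta]

theorem values_subset_adom (T : Set (Tup S)) (s : Tup S) (A : Attr S) :
    values T s A ⊆ adom T A := fun _ ⟨t, ht, _, hta⟩ => ⟨t, ht, hta⟩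

/-- The properties of a star-table that matter for the chase and for repairs. -/
structure Admissible (T : Set (Tup S)) : Prop where
  finite : T.Finite
  nonempty : ∀ t ∈ T, t.sch.Nonempty
  closed : ∀ t ∈ T, ∀ A ∈ t.sch, det A ⊆ t.sch

theorem Warehouse.admissible (W : Warehouse S) : Admissible W.table where
  finite := by
    have : W.table = (⋃ i, (W.D i : Set (Tup S))) ∪ W.F := by
      ext t; simp [Warehouse.table]
    rw [this]
    exact (Set.finite_iUnion fun i => (W.D i).finite_toSet).union W.F.finite_toSet
  nonempty := by
    rintro t (⟨i, ht⟩ | ht)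
    · exact ⟨_, W.D_key i t ht⟩
    · obtain ⟨k, hk⟩ := W.F_val t ht
      exact ⟨_, hk⟩
  closed := by
    rintro t (⟨i, ht⟩ | ht) A hA
    · rcases W.D_sch i t ht hA with rfl | ⟨j, rfl⟩ <;>
        exact Set.singleton_subset_iff.2 (W.D_key i t ht)
    · exact (det_subset_keys A).trans (W.F_key t ht)

theorem adom_finite {T : Set (Tup S)} (hT : T.Finite) (A : Attr S) : (adom T A).Finite := by
  refine Set.Finite.subset ((hT.image fun t => t A).preimage (f := some)
    (Option.some_injective _).injOn) ?_
  rintro a ⟨t, ht, hta⟩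
  exact ⟨t, ht, hta⟩

theorem values_finite {T : Set (Tup S)} (hT : Admissible T) (s : Tup S) (A : Attr S) :
    (values T s A).Finite :=
  (adom_finite hT.finite A).subset (values_subset_adom T s A)

theorem mem_values_self {T : Set (Tup S)} (hT : Admissible T) {s : Tup S} (hs : s ∈ T)
    {A : Attr S} {a : A.dom} (h : s A = some a) : a ∈ values T s A :=
  ⟨s, hs, fun _ hB => ⟨hT.closed s hs A (Tup.mem_sch.2 ⟨a, h⟩) hB, rfl⟩, h⟩

/-- All values of `t` are attached by `T` to the keys of `s`. -/
def Below (T : Set (Tup S)) (s t : Tup S) : Prop := ∀ A a, t A = some a → a ∈ values T s A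

theorem Below.agree {T : Set (Tup S)} {s t : Tup S} (h : Below T s t) {A : Attr S}
    (hA : det A ⊆ t.sch) : Agree A t s := fun B hB => by
  obtain ⟨b, hb⟩ := Tup.mem_sch.1 (hA hB)
  exact ⟨hA hB, hb.trans (eq_of_mem_values_key (det_subset_keys A hB) (h B b hb)).symm⟩

/-! ### Characterisation of the true tuples. -/

theorem below_of_isTrue {T : Set (Tup S)} (hT : Admissible T) {t : Tup S} (h : IsTrue T t) :
    t.sch.Nonempty ∧ ∃ s ∈ T, Below T s t := by
  induction h with
  | @base t ht => exact ⟨hT.nonempty t ht, t, ht, fun A a h => mem_values_self hT ht h⟩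
  | @sub q t _ hq hqt ih =>
    obtain ⟨-, s, hs, hst⟩ := ih
    refine ⟨hq, s, hs, fun A a h => hst A a ?_⟩
    rw [← hqt A (Tup.mem_sch.2 ⟨a, h⟩), h]
  | @infer t r u f hf _ _ hX hag hA huA hu iht ihr =>
    obtain ⟨-, s, hs, hst⟩ := iht
    obtain ⟨-, s', hs', hst'⟩ := ihr
    obtain ⟨X, A⟩ := f
    obtain ⟨hk, rfl⟩ := mem_starFD.1 hf
    simp only at *
    refine ⟨⟨A, (Tup.mem_sch_congr huA).2 hA⟩, s, hs, fun B b h => ?_⟩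
    · by_cases hB : B = A
      · subst hB
        have h1 : Agree B t r := fun C hC => ⟨hX hC, hag C hC⟩
        -- The two premises lie below `s` and `s'` and share the keys `det B`. Hence so do `s` and
        -- `s'`, and the imported value is already attached to `s`.
        have h2 : Agree B s s' :=
          (hst.agree hX).symm.trans (h1.trans (hst'.agree fun C hC => (h1.symm C hC).1))
        rw [values_congr T h2]
        exact hst' B b (huA ▸ h)
      · exact hst B b (hu B hB ▸ h)

/-- Start from `s` and overwrite its attributes with those of `t` one at a time. Keys already
coincide; a value at another attribute comes from a tuple of `T` agreeing with `s` on the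
determining keys, so one inference installs it. Passing to a sub-tuple at the end leaves `t`. -/
theorem isTrue_of_below {T : Set (Tup S)} {s t : Tup S} (hs : s ∈ T)
    (ht : t.sch.Nonempty) (h : Below T s t) : IsTrue T t := by
  classical
  have := Fintype.ofFinite (Attr S)
  let u : Finset (Attr S) → Tup S := fun Z A => if A ∈ Z ∧ A ∈ t.sch then t A else s A
  have key : ∀ Z, ∀ B ∈ keys S, u Z B = s B := by
    intro Z B hB
    by_cases hc : B ∈ Z ∧ B ∈ t.sch
    · obtain ⟨b, hb⟩ := Tup.mem_sch.1 hc.2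
      rw [eq_of_mem_values_key hB (h B b hb), ← hb]
      exact if_pos hc
    · exact if_neg hc
  have main : ∀ Z, IsTrue T (u Z) := by
    intro Z
    induction Z using Finset.induction_on with
    | empty =>
      have : u ∅ = s := by funext A; simp [u]
      exact this ▸ IsTrue.base hs
    | insert A Z hAZ ih =>
      have same : ∀ B, B ≠ A → u (insert A Z) B = u Z B := by
        intro B hB; simp [u, hB]
      by_cases hA : A ∈ t.sch
      · by_cases hk : A ∈ keys S
        · have : u (insert A Z) = u Z := by
            funext B
            by_cases hB : B = A
            · subst hB; rw [key _ _ hk, key _ _ hk]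
            · exact same B hB
          exact this ▸ ih
        · obtain ⟨a, ha⟩ := Tup.mem_sch.1 hA
          obtain ⟨r, hr, hrs, hra⟩ := h A a ha
          refine IsTrue.infer ⟨det A, A⟩ (mem_starFD.2 ⟨hk, rfl⟩) ih (IsTrue.base hr) ?_ ?_
            (Tup.mem_sch.2 ⟨a, hra⟩) ?_ same
          · intro B hB
            change u Z B ≠ none
            rw [key Z B (det_subset_keys A hB)]
            exact (hrs.symm B hB).1
          · intro B hB
            rw [key Z B (det_subset_keys A hB), (hrs B hB).2]
          · change u (insert A Z) A = r A
            simp [u, hA, hra, ha]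
      · have : u (insert A Z) = u Z := by
          funext B
          by_cases hB : B = A
          · subst hB; simp [u, hA]
          · exact same B hB
        exact this ▸ ih
  exact (main Finset.univ).sub ht fun A hA => by simp [u, hA]

theorem trueTuples_finite {T : Set (Tup S)} (hT : Admissible T) : (trueTuples T).Finite := by
  refine Set.Finite.subset (Set.Finite.pi' (t := fun A => insert none (some '' adom T A))
    fun A => ((adom_finite hT.finite A).image _).insert _) ?_
  intro t ht A
  obtain ⟨-, s, -, hst⟩ := below_of_isTrue hT ht
  rcases h : t A with _ | a
  · exact Or.inl rfl
  · exact Or.inr ⟨a, values_subset_adom T s A (hst A a h), rfl⟩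

/-! ### Choices and repairs -/

/-- A choice picks, for every key value and every attribute that it determines, one of the values
that `T` attaches to it. -/
structure IsChoice (T : Set (Tup S)) (c : Tup S → Tup S) : Prop where
  mem : ∀ s A a, c s A = some a → a ∈ values T s A
  dfd : ∀ s A, (values T s A).Nonempty → A ∈ (c s).sch
  coh : ∀ s s' A, Agree A s s' → c s A = c s' A

theorem IsChoice.key {T : Set (Tup S)} (hT : Admissible T) {c : Tup S → Tup S}
    (hc : IsChoice T c) {s : Tup S} (hs : s ∈ T) {A : Attr S} (hA : A ∈ keys S) :
    c s A = s A := by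
  refine Option.ext fun a => ⟨fun h => eq_of_mem_values_key hA (hc.mem s A a h), fun h => ?_⟩
  obtain ⟨b, hb⟩ := Tup.mem_sch.1 (hc.dfd s A ⟨a, mem_values_self hT hs h⟩)
  rw [hb, ← eq_of_mem_values_key hA (hc.mem s A b hb), h]

/-- `P` is a preference: a preferred value is picked whenever one is available, and any value
otherwise. Coherence is automatic, because the pick depends only on two sets that are equal for
agreeing tuples. -/
theorem exists_isChoice (T : Set (Tup S)) (P : Tup S → MTup S)
    (hP : ∀ s s' A, Agree A s s' → P s A = P s' A) :
    ∃ c, IsChoice T c ∧ ∀ s A, (values T s A ∩ P s A).Nonempty → ∃ v ∈ P s A, c s A = some v := by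
  classical
  let g : (A : Attr S) → Set A.dom → Set A.dom → Option A.dom := fun A X Y =>
    if h : (X ∩ Y).Nonempty then some h.some else if h : X.Nonempty then some h.some else none
  refine ⟨fun s A => g A (values T s A) (P s A), ⟨?_, ?_, ?_⟩, ?_⟩
  · intro s A a h
    simp only [g] at h
    split_ifs at h with h1 h2
    · rw [← Option.some.inj h]; exact h1.some_mem.1
    · rw [← Option.some.inj h]; exact h2.some_mem
  · intro s A h
    refine Tup.mem_sch.2 ?_
    simp only [g]
    split_ifs
    · exact ⟨_, rfl⟩
    · exact ⟨_, rfl⟩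
  · intro s s' A h
    simp only [values_congr T h, hP s s' A h]
  · intro s A h
    exact ⟨h.some, h.some_mem.2, dif_pos h⟩

/-- The true tuples of the repair that belongs to a choice. -/
def chosen (T : Set (Tup S)) (c : Tup S → Tup S) : Set (Tup S) :=
  {t | t.sch.Nonempty ∧ ∃ s ∈ T, Below T s t ∧
    ∀ A, det A ⊆ t.sch → ∀ a, t A = some a → c s A = some a}

theorem chosen_subset {T : Set (Tup S)} {c : Tup S → Tup S} : chosen T c ⊆ trueTuples T :=
  fun _ ⟨h, _, hs, hst, _⟩ => isTrue_of_below hs h hst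

/-- The set is closed under both inference rules. A sub-tuple has fewer keys and hence fewer
constraints; an inferred value was chosen at the keys of the other premise, and coherence carries it
over. -/
theorem trueTuples_chosen {T : Set (Tup S)} {c : Tup S → Tup S} (hc : IsChoice T c) :
    trueTuples (chosen T c) = chosen T c := by
  refine Set.Subset.antisymm (fun t ht => ?_) fun t ht => IsTrue.base ht
  induction (show IsTrue _ t from ht) with
  | base h => exact h
  | @sub q t h hq hqt ih =>
    obtain ⟨-, s, hs, hst, hcs⟩ := ih h
    have hv : ∀ A a, q A = some a → t A = some a := fun A a h => by
      rw [← hqt A (Tup.mem_sch.2 ⟨a, h⟩), h]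
    refine ⟨hq, s, hs, fun A a h => hst A a (hv A a h), fun A hA a h => hcs A ?_ a (hv A a h)⟩
    intro B hB
    obtain ⟨b, hb⟩ := Tup.mem_sch.1 (hA hB)
    exact Tup.mem_sch.2 ⟨b, hv B b hb⟩
  | @infer t r u f hf ht' hr' hX hag hA huA hu iht ihr =>
    obtain ⟨-, s, hs, hst, hcs⟩ := iht ht'
    obtain ⟨-, s', hs', hst', hcs'⟩ := ihr hr'
    obtain ⟨X, A⟩ := f
    obtain ⟨hk, rfl⟩ := mem_starFD.1 hf
    simp only at *
    have h1 : Agree A t r := fun C hC => ⟨hX hC, hag C hC⟩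
    have h2 : Agree A s s' :=
      (hst.agree hX).symm.trans (h1.trans (hst'.agree fun C hC => (h1.symm C hC).1))
    refine ⟨⟨A, (Tup.mem_sch_congr huA).2 hA⟩, s, hs, fun B b h => ?_, fun B hdB b h => ?_⟩
    · by_cases hB : B = A
      · subst hB
        rw [values_congr T h2]
        exact hst' B b (huA ▸ h)
      · exact hst B b (hu B hB ▸ h)
    · by_cases hB : B = A
      · subst hB
        rw [hc.coh _ _ _ h2]
        exact hcs' B (fun C hC => (h1.symm C hC).1) b (huA ▸ h)
      · refine hcs B (fun C hC => ?_) b (hu B hB ▸ h)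
        -- The attribute just added is not a key, so the keys determining `B` were present before.
        have hCA : C ≠ A := fun e => hk (e ▸ det_subset_keys B hC)
        exact (Tup.mem_sch_congr (hu C hCA)).1 (hdB hC)

theorem satisfies_iff {R : Set (Tup S)} : Satisfies R ↔
    ∀ t ∈ trueTuples R, ∀ s ∈ trueTuples R, ∀ A, A ∉ keys S → Agree A t s →
      ∀ a b, t A = some a → s A = some b → a = b := by
  constructor
  · intro h t ht s hs A hA hts a b hta hsb
    by_contra hab
    have : t ∈ conflTuples R := ⟨ht, ⟨det A, A⟩, mem_starFD.2 ⟨hA, rfl⟩, fun B hB => (hts B hB).1,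
      Tup.mem_sch.2 ⟨a, hta⟩, s, hs, fun B hB => (hts B hB).2.symm, Tup.mem_sch.2 ⟨b, hsb⟩, by
        simpa [hta, hsb] using Ne.symm hab⟩
    rw [show conflTuples R = ∅ from h] at this
    exact this
  · intro h
    refine Set.eq_empty_iff_forall_notMem.2 ?_
    rintro t ⟨ht, ⟨X, A⟩, hf, hX, hA, s, hs, hag, hsA, hne⟩
    obtain ⟨hk, rfl⟩ := mem_starFD.1 hf
    obtain ⟨a, ha⟩ := Tup.mem_sch.1 hA
    obtain ⟨b, hb⟩ := Tup.mem_sch.1 hsA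
    refine hne ?_
    simp only at *
    rw [ha, hb, h t ht s hs A hk (fun B hB => ⟨hX hB, (hag B hB).symm⟩) a b ha hb]

/-- A value that appears without its determining keys cannot be in conflict, which is why `chosen`
constrains only the attributes `A` with `det A ⊆ t.sch`. If a true tuple carries such an `A` with a
value other than the chosen one, the tuple of `T` that supplies the chosen value puts it in
conflict. -/
theorem preRepair_chosen {T : Set (Tup S)} (hT : Admissible T) {c : Tup S → Tup S}
    (hc : IsChoice T c) : PreRepair T (chosen T c) where
  finite := (trueTuples_finite hT).subset chosen_subset
  sub_true := by rw [trueTuples_chosen hc]; exact chosen_subset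
  cons_sub := by
    rw [trueTuples_chosen hc]
    rintro t ⟨ht, htc⟩
    obtain ⟨hne, s, hs, hst⟩ := below_of_isTrue hT ht
    refine ⟨hne, s, hs, hst, fun A hA a ha => ?_⟩
    obtain ⟨b, hb⟩ := Tup.mem_sch.1 (hc.dfd s A ⟨a, hst A a ha⟩)
    by_cases hk : A ∈ keys S
    · rw [hc.key hT hs hk, eq_of_mem_values_key hk (hst A a ha)]
    rw [hb]
    by_contra hab
    obtain ⟨r, hr, hrs, hrb⟩ := hc.mem s A b hb
    refine htc ⟨ht, ⟨det A, A⟩, mem_starFD.2 ⟨hk, rfl⟩, hA, Tup.mem_sch.2 ⟨a, ha⟩, r,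
      IsTrue.base hr, fun B hB => ?_, Tup.mem_sch.2 ⟨b, hrb⟩, ?_⟩
    · rw [(hrs B hB).2, (hst.agree hA B hB).2]
    · simp only [hrb, ha]; exact hab
  sat := by
    rw [satisfies_iff, trueTuples_chosen hc]
    rintro t ⟨-, s, hs, hst, hcs⟩ t' ⟨-, s', hs', hst', hcs'⟩ A hA hag a b ha hb
    have hA' : det A ⊆ t'.sch := fun B hB => (hag.symm B hB).1
    have hA : det A ⊆ t.sch := fun B hB => (hag B hB).1
    have h1 : Agree A s s' := (hst.agree hA).symm.trans (hag.trans (hst'.agree hA'))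
    have := hcs A hA a ha
    rw [hc.coh _ _ _ h1, hcs' A hA' b hb] at this
    exact (Option.some.inj this).symm

/-- For maximality, a larger consistent `R` contains the pair of `det A` and the chosen `A`-value.
The dependencies then force every true tuple of `R` with these keys to carry that value. -/
theorem isRepair_chosen {T : Set (Tup S)} (hT : Admissible T) {c : Tup S → Tup S}
    (hc : IsChoice T c) : IsRepair T (chosen T c) := by
  classical
  refine ⟨preRepair_chosen hT hc, fun R hR hsub => Set.Subset.antisymm hsub fun t ht => ?_⟩
  rw [trueTuples_chosen hc] at hsub ⊢
  obtain ⟨hne, s, hs, hst⟩ := below_of_isTrue hT (hR.sub_true ht)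
  refine ⟨hne, s, hs, hst, fun A hA a ha => ?_⟩
  obtain ⟨b, hb⟩ := Tup.mem_sch.1 (hc.dfd s A ⟨a, hst A a ha⟩)
  by_cases hk : A ∈ keys S
  · rw [hc.key hT hs hk, eq_of_mem_values_key hk (hst A a ha)]
  have hag := hst.agree hA
  have hr : (c s).restrict (det A ∪ {A}) ∈ chosen T c := by
    refine ⟨⟨A, Tup.mem_sch.2 ⟨b, Tup.restrict_eq_some.2 ⟨Or.inr rfl, hb⟩⟩⟩, s, hs, ?_, ?_⟩
    · intro B e h
      exact hc.mem s B e (Tup.restrict_eq_some.1 h).2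
    · intro B _ e h
      exact (Tup.restrict_eq_some.1 h).2
  have := satisfies_iff.1 hR.sat t ht _ (hsub hr) A hk (fun B hB => ⟨hA hB, ?_⟩) a b ha
    (Tup.restrict_eq_some.2 ⟨Or.inr rfl, hb⟩)
  · rw [this, hb]
  · rw [Tup.restrict_apply (Or.inl hB), hc.key hT hs (det_subset_keys A hB), (hag B hB).2]

/-- Let the choice prefer the values that `R` itself attaches, which are unique since `R` satisfies
the dependencies. Then the true tuples of `R` are among the chosen ones, and maximality of `R` gives
equality. -/
theorem exists_choice_of_isRepair {T R : Set (Tup S)} (hT : Admissible T) (hR : IsRepair T R) :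
    ∃ c, IsChoice T c ∧ trueTuples R = chosen T c := by
  obtain ⟨c, hc, hcP⟩ := exists_isChoice T (values (trueTuples R))
    fun s s' A h => values_congr _ h
  refine ⟨c, hc, ?_⟩
  rw [← trueTuples_chosen hc]
  refine hR.2 _ (preRepair_chosen hT hc) fun t ht => ?_
  rw [trueTuples_chosen hc]
  obtain ⟨hne, s, hs, hst⟩ := below_of_isTrue hT (hR.1.sub_true ht)
  refine ⟨hne, s, hs, hst, fun A hA a ha => ?_⟩
  by_cases hk : A ∈ keys S
  · rw [hc.key hT hs hk, eq_of_mem_values_key hk (hst A a ha)]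
  obtain ⟨b, ⟨r, hr, hrs, hrb⟩, hb⟩ := hcP s A ⟨a, hst A a ha, t, ht, hst.agree hA, ha⟩
  rw [hb, satisfies_iff.1 hR.1.sat t ht r hr A hk ((hst.agree hA).trans hrs.symm) a b ha hrb]

/-! ### The m-Chase -/

theorem MTup.mem_sch {σ : MTup S} {A : Attr S} : A ∈ σ.sch ↔ (σ A).Nonempty := Iff.rfl

theorem MTup.mem_restrict {σ : MTup S} {X : Set (Attr S)} {A : Attr S} {a : A.dom} :
    a ∈ σ.restrict X A ↔ a ∈ σ A ∧ A ∈ X := Iff.rfl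

theorem MTup.ext {σ τ : MTup S} (h : ∀ A a, a ∈ σ A ↔ a ∈ τ A) : σ = τ :=
  funext fun A => Set.ext (h A)

theorem MTup.Le.antisymm {σ τ : MTup S} (h : σ.Le τ) (h' : τ.Le σ) : σ = τ :=
  MTup.ext fun A _ => ⟨fun ha => h A ha, fun ha => h' A ha⟩

theorem MTup.mem_union_restrict {σ τ : MTup S} {A B : Attr S} {b : B.dom} :
    b ∈ σ.union (τ.restrict {A}) B ↔ b ∈ σ B ∨ b ∈ τ B ∧ B = A := Iff.rfl

theorem MTup.le_union {σ τ : MTup S} : σ.Le (σ.union τ) := fun _ _ h => Or.inl h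

/-- The soundness of an m-tuple: it has the keys of a tuple of `T`, and its values are attached by
`T` to them. -/
def Sound (T : Set (Tup S)) (σ : MTup S) : Prop :=
  ∃ s ∈ T, σ.Le (values T s) ∧ ∀ A ∈ keys S, values T s A ⊆ σ A

theorem sound_ofTup {T : Set (Tup S)} (hT : Admissible T) {s : Tup S} (hs : s ∈ T) :
    Sound T (MTup.ofTup s) :=
  ⟨s, hs, fun _ _ h => mem_values_self hT hs h, fun _ hA _ h => eq_of_mem_values_key hA h⟩

theorem agree_of_tuples {T : Set (Tup S)} {σ σ' : MTup S} {s s' : Tup S} {A : Attr S}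
    (hσ : σ.Le (values T s)) (hσ' : σ'.Le (values T s')) (hX : det A ⊆ σ.sch)
    (h : ((σ.restrict (det A)).tuples ∩ (σ'.restrict (det A)).tuples).Nonempty) :
    Agree A s s' := by
  obtain ⟨x, ⟨hx, hxσ⟩, -, hxσ'⟩ := h
  intro B hB
  have hBx : B ∈ x.sch := by
    rw [hx]
    obtain ⟨b, hb⟩ := hX hB
    exact ⟨b, hb, hB⟩
  obtain ⟨b, hb⟩ := Tup.mem_sch.1 hBx
  have h1 := eq_of_mem_values_key (det_subset_keys A hB) (hσ B (hxσ B b hb).1)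
  have h2 := eq_of_mem_values_key (det_subset_keys A hB) (hσ' B (hxσ' B b hb).1)
  exact ⟨Tup.mem_sch.2 ⟨b, h1⟩, h1.trans h2.symm⟩

theorem Sound.union {T : Set (Tup S)} {σ σ' : MTup S} {A : Attr S} (hσ : Sound T σ)
    (hσ' : Sound T σ') (hX : det A ⊆ σ.sch)
    (h : ((σ.restrict (det A)).tuples ∩ (σ'.restrict (det A)).tuples).Nonempty) :
    Sound T (σ.union (σ'.restrict {A})) := by
  obtain ⟨s, hs, hσs, hk⟩ := hσ
  obtain ⟨s', hs', hσs', -⟩ := hσ'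
  refine ⟨s, hs, ?_, fun B hB b hb => Or.inl (hk B hB hb)⟩
  rintro B b (hb | ⟨hb, rfl⟩)
  · exact hσs B hb
  · rw [values_congr T (agree_of_tuples hσs hσs' hX h)]
    exact hσs' B hb

theorem mem_mChaseRule {Sig : Set (MTup S)} {σ σ' τ : MTup S} {A : Attr S}
    (h : τ ∈ mChaseRule Sig σ σ' A) :
    (τ ∈ Sig ∧ τ ≠ σ ∧ τ ≠ σ') ∨ τ = σ.union (σ'.restrict {A}) ∨
      τ = σ'.union (σ.restrict {A}) := by
  unfold mChaseRule at h
  simp only at h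
  split_ifs at h <;> simp at h <;> tauto

/-- No information is lost by a step: a discarded m-tuple is below the one that is kept. -/
theorem exists_le_mChaseRule {Sig : Set (MTup S)} {σ σ' τ : MTup S} {A : Attr S}
    (h : τ ∈ Sig) : ∃ τ' ∈ mChaseRule Sig σ σ' A, τ.Le τ' := by
  by_cases h1 : τ = σ
  · subst h1
    unfold mChaseRule
    simp only
    split_ifs with h2 h3
    · exact ⟨_, Or.inr rfl, fun A _ ha => h2 A (Or.inl ha)⟩
    · exact ⟨_, Or.inr rfl, MTup.le_union⟩
    · exact ⟨_, Or.inr (Or.inl rfl), MTup.le_union⟩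
  by_cases h1' : τ = σ'
  · subst h1'
    unfold mChaseRule
    simp only
    split_ifs with h2 h3
    · exact ⟨_, Or.inr rfl, MTup.le_union⟩
    · exact ⟨_, Or.inr rfl, fun A _ ha => h3 A (Or.inl ha)⟩
    · exact ⟨_, Or.inr (Or.inr rfl), MTup.le_union⟩
  · refine ⟨τ, ?_, fun A _ ha => ha⟩
    unfold mChaseRule
    simp only
    split_ifs <;> exact Or.inl ⟨h, by simp [h1, h1']⟩

/-- The rule removes `σ`, so if `σ` is still in the table, it is one of the two new m-tuples. Both
of them contain `σ' A`. -/
theorem subset_of_mChaseRule_eq {Sig : Set (MTup S)} {σ σ' : MTup S} {A : Attr S} (hσ : σ ∈ Sig)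
    (h : mChaseRule Sig σ σ' A = Sig) : σ' A ⊆ σ A := by
  intro a ha
  rw [← h] at hσ
  rcases mem_mChaseRule hσ with ⟨-, h, -⟩ | h | h
  · exact absurd rfl h
  · rw [h]; exact Or.inr ⟨ha, rfl⟩
  · rw [h]; exact Or.inl ha

/-- The invariant of the m-Chase. -/
structure ChaseInv (T : Set (Tup S)) (Sig : Set (MTup S)) : Prop where
  finite : Sig.Finite
  sound : ∀ σ ∈ Sig, Sound T σ
  complete : ∀ s ∈ T, ∃ σ ∈ Sig, (MTup.ofTup s).Le σ

theorem chaseInv_init {T : Set (Tup S)} (hT : Admissible T) : ChaseInv T (MTup.ofTup '' T) where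
  finite := hT.finite.image _
  sound := by
    rintro _ ⟨s, hs, rfl⟩
    exact sound_ofTup hT hs
  complete s hs := ⟨_, ⟨s, hs, rfl⟩, fun _ _ h => h⟩

theorem ChaseInv.step {T : Set (Tup S)} {Sig Sig' : Set (MTup S)} (h : ChaseInv T Sig)
    (hst : MChaseStep Sig Sig') : ChaseInv T Sig' := by
  obtain ⟨σ, hσ, σ', hσ', ⟨X, A⟩, hf, hX, hX', -, hn, rfl, -⟩ := hst
  obtain ⟨hk, rfl⟩ := mem_starFD.1 hf
  simp only at *
  refine ⟨?_, fun τ hτ => ?_, fun s hs => ?_⟩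
  · refine Set.Finite.subset (h.finite.union (Set.toFinite
      {σ.union (σ'.restrict {A}), σ'.union (σ.restrict {A})})) fun τ hτ => ?_
    rcases mem_mChaseRule hτ with h | h
    · exact Or.inl h.1
    · exact Or.inr h
  · rcases mem_mChaseRule hτ with h' | rfl | rfl
    · exact h.sound τ h'.1
    · exact (h.sound σ hσ).union (h.sound σ' hσ') hX hn
    · exact (h.sound σ' hσ').union (h.sound σ hσ) hX' (by rwa [Set.inter_comm])
  · obtain ⟨τ, hτ, hsτ⟩ := h.complete s hs
    obtain ⟨τ', hτ', hττ'⟩ := exists_le_mChaseRule (σ := σ) (σ' := σ') (A := A) hτ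
    exact ⟨τ', hτ', fun B _ hb => hττ' B (hsτ B hb)⟩

theorem ChaseInv.reflTransGen {T : Set (Tup S)} {Sig Sig' : Set (MTup S)} (h : ChaseInv T Sig)
    (hst : Relation.ReflTransGen MChaseStep Sig Sig') : ChaseInv T Sig' := by
  induction hst with
  | refl => exact h
  | tail _ h' ih => exact ih.step h'

/-- Supplies the common `X`-value that a chase step asks for: on keys, a sound m-tuple is its base
tuple. -/
theorem ofTup_mem_tuples {T : Set (Tup S)} (hT : Admissible T) {σ : MTup S} {s : Tup S}
    (hs : s ∈ T) (hσ : σ.Le (values T s)) (hk : ∀ A ∈ keys S, values T s A ⊆ σ A) {A : Attr S} :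
    s.restrict (det A) ∈ (σ.restrict (det A)).tuples := by
  have h : ∀ B ∈ keys S, ∀ b, s B = some b ↔ b ∈ σ B := fun B hB b =>
    ⟨fun h => hk B hB (mem_values_self hT hs h), fun h => eq_of_mem_values_key hB (hσ B h)⟩
  refine ⟨Set.ext fun B => ?_, fun B b hb => ?_⟩
  · rw [Tup.mem_sch, MTup.mem_sch]
    refine exists_congr fun b => ?_
    rw [Tup.restrict_eq_some, MTup.mem_restrict, and_comm]
    exact and_congr_left fun hB => h B (det_subset_keys A hB) b
  · obtain ⟨hB, hb⟩ := Tup.restrict_eq_some.1 hb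
    exact ⟨(h B (det_subset_keys A hB) b).1 hb, hB⟩

/-- The m-tuples of an output of the m-Chase are saturated. -/
theorem ChaseInv.eq_values {T : Set (Tup S)} (hT : Admissible T) {Sig : Set (MTup S)}
    (h : ChaseInv T Sig) (hfix : ∀ Sig', ¬ MChaseStep Sig Sig') {σ : MTup S} (hσ : σ ∈ Sig) :
    ∃ s ∈ T, σ = values T s := by
  obtain ⟨s, hs, hle, hk⟩ := h.sound σ hσ
  refine ⟨s, hs, hle.antisymm fun A a ha => ?_⟩
  by_cases hA : A ∈ keys S
  · exact hk A hA ha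
  obtain ⟨t, ht, hts, hta⟩ := ha
  -- The missing value comes from a tuple `t`, which is covered by some `σ'` of the table sharing
  -- the keys `det A` with `σ`. As no step is possible, applying the rule to `σ` and `σ'` changes
  -- nothing, so `σ` already has the value.
  obtain ⟨σ', hσ', hle'⟩ := h.complete t ht
  have haσ' : a ∈ σ' A := hle' A hta
  obtain ⟨s', hs', hσs', hk'⟩ := h.sound σ' hσ'
  refine subset_of_mChaseRule_eq (σ' := σ') hσ ?_ haσ'
  by_contra hne
  have h1 := ofTup_mem_tuples hT hs hle hk (A := A)
  have h2 := ofTup_mem_tuples hT hs' hσs' hk' (A := A)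
  have hd : det A ⊆ σ.sch := fun B hB => by
    obtain ⟨b, hb⟩ := Tup.mem_sch.1 (hts.symm B hB).1
    exact ⟨b, hk B (det_subset_keys A hB) (mem_values_self hT hs hb)⟩
  have hd' : det A ⊆ σ'.sch := fun B hB => by
    obtain ⟨b, hb⟩ := Tup.mem_sch.1 (hts B hB).1
    exact ⟨b, hle' B hb⟩
  have h3 : s'.restrict (det A) = s.restrict (det A) := by
    refine Tup.ext fun B b => ?_
    rw [Tup.restrict_eq_some, Tup.restrict_eq_some]
    refine and_congr_right fun hB => ?_
    obtain ⟨b', hb'⟩ := Tup.mem_sch.1 (hts B hB).1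
    have e : s' B = some b' :=
      eq_of_mem_values_key (det_subset_keys A hB) (hσs' B (hle' B hb'))
    rw [e, ← (hts B hB).2, hb']
  exact hfix _ ⟨σ, hσ, σ', hσ', ⟨det A, A⟩, mem_starFD.2 ⟨hA, rfl⟩, hd, hd', Or.inr ⟨a, haσ'⟩,
    ⟨_, h1, h3 ▸ h2⟩, rfl, hne⟩

/-- Every tuple of `T` that has all keys is saturated in an output of the m-Chase. -/
theorem ChaseInv.values_mem {T : Set (Tup S)} (hT : Admissible T) {Sig : Set (MTup S)}
    (h : ChaseInv T Sig) (hfix : ∀ Sig', ¬ MChaseStep Sig Sig') {s : Tup S} (hs : s ∈ T)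
    (hk : keys S ⊆ s.sch) : values T s ∈ Sig := by
  obtain ⟨σ, hσ, hle⟩ := h.complete s hs
  obtain ⟨s', hs', rfl⟩ := h.eq_values hT hfix hσ
  -- The covering m-tuple is saturated at some `s'`. Since `s` has all keys, `s'` has the same ones,
  -- and these determine all the values.
  suffices values T s = values T s' by rwa [this]
  refine funext fun A => values_congr T fun B hB => ⟨hk (det_subset_keys A hB), ?_⟩
  obtain ⟨b, hb⟩ := Tup.mem_sch.1 (hk (det_subset_keys A hB))
  rw [hb, eq_of_mem_values_key (det_subset_keys A hB) (hle B hb)]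

/-! ### Termination of the m-Chase -/

/-- The values of `T` that an m-tuple lacks. -/
def lacking (T : Set (Tup S)) (σ : MTup S) : Set (Σ A : Attr S, A.dom) :=
  {x | x.2 ∈ adom T x.1 ∧ x.2 ∉ σ x.1}

theorem lacking_finite {T : Set (Tup S)} (hT : Admissible T) (σ : MTup S) :
    (lacking T σ).Finite := by
  refine Set.Finite.subset (s := ⋃ A, Sigma.mk A '' adom T A)
    (Set.finite_iUnion fun A => (adom_finite hT.finite A).image _) ?_
  rintro ⟨A, a⟩ ⟨h, -⟩
  exact Set.mem_iUnion.2 ⟨A, a, h, rfl⟩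

/-- The weight of an m-tuple, which decreases when values are added. -/
noncomputable def weight (T : Set (Tup S)) (σ : MTup S) : ℕ := (lacking T σ).ncard + 1

theorem weight_le {T : Set (Tup S)} (hT : Admissible T) {σ τ : MTup S} (h : σ.Le τ) :
    weight T τ ≤ weight T σ :=
  Nat.succ_le_succ (Set.ncard_le_ncard (fun _ hx => ⟨hx.1, fun hσ => hx.2 (h _ hσ)⟩)
    (lacking_finite hT σ))

theorem weight_lt {T : Set (Tup S)} (hT : Admissible T) {σ τ : MTup S} (h : σ.Le τ)
    (hne : τ ≠ σ) (hτ : ∀ A, τ A ⊆ adom T A) : weight T τ < weight T σ := by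
  refine Nat.succ_lt_succ (Set.ncard_lt_ncard ⟨fun _ hx => ⟨hx.1, fun hσ => hx.2 (h _ hσ)⟩,
    fun hsub => hne (MTup.Le.antisymm (fun A a ha => ?_) h)⟩ (lacking_finite hT σ))
  by_contra ha'
  exact (hsub (show (⟨A, a⟩ : Σ A : Attr S, A.dom) ∈ lacking T σ from ⟨hτ A ha, ha'⟩)).2 ha

theorem Sound.subset_adom {T : Set (Tup S)} {σ : MTup S} (h : Sound T σ) (A : Attr S) :
    σ A ⊆ adom T A := by
  obtain ⟨s, -, hle, -⟩ := h
  exact (hle A).trans (values_subset_adom T s A)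

open Classical in
/-- The weight of a finite m-table. -/
noncomputable def tableWeight (T : Set (Tup S)) (Sig : Set (MTup S)) : ℕ :=
  if h : Sig.Finite then ∑ σ ∈ h.toFinset, weight T σ else 0

theorem tableWeight_coe (T : Set (Tup S)) (Z : Finset (MTup S)) :
    tableWeight T (Z : Set (MTup S)) = ∑ σ ∈ Z, weight T σ := by
  rw [tableWeight, dif_pos Z.finite_toSet, Finset.finite_toSet_toFinset]

/-- Adding values never increases a weight. If only one of the two m-tuples is kept, the positive
weight of the other disappears; this is the purpose of the `+ 1` in `weight`. If both are kept, one
of them has strictly grown, as otherwise the table would not have changed. -/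
theorem tableWeight_lt {T : Set (Tup S)} (hT : Admissible T) {Sig Sig' : Set (MTup S)}
    (h : ChaseInv T Sig) (hst : MChaseStep Sig Sig') : tableWeight T Sig' < tableWeight T Sig := by
  classical
  have hinv := h.step hst
  obtain ⟨σ, hσ, σ', hσ', ⟨X, A⟩, hf, -, -, -, -, rfl, hne⟩ := hst
  simp only at *
  set τ := σ.union (σ'.restrict {A}) with hτ
  set τ' := σ'.union (σ.restrict {A}) with hτ'
  have hle : σ.Le τ := MTup.le_union
  have hle' : σ'.Le τ' := MTup.le_union
  -- Applying the rule to an m-tuple and itself leaves the table unchanged, so it is no step.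
  have hσσ' : σ ≠ σ' := by
    rintro rfl
    refine hne ?_
    have e : σ.union (σ.restrict {A}) = σ := MTup.ext fun B b => by
      rw [MTup.mem_union_restrict]; tauto
    unfold mChaseRule
    simp only [e]
    rw [if_pos (show σ.Le σ from fun _ _ h => h)]
    ext ρ
    simp only [Set.mem_union, Set.mem_sdiff, Set.mem_insert_iff, Set.mem_singleton_iff]
    by_cases hρ : ρ = σ
    · subst hρ; simp [hσ]
    · simp [hρ]
  obtain ⟨Z, rfl⟩ : ∃ Z : Finset (MTup S), Sig = Z := ⟨h.finite.toFinset, by simp⟩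
  set Y := (Z.erase σ).erase σ' with hY
  have hYc : (Z : Set (MTup S)) \ {σ, σ'} = (Y : Set (MTup S)) := by
    ext ρ
    simp only [hY, Set.mem_sdiff, Finset.mem_coe, Set.mem_insert_iff, Set.mem_singleton_iff,
      Finset.mem_erase]
    tauto
  have hsum : (∑ ρ ∈ Y, weight T ρ) + weight T σ' + weight T σ = ∑ ρ ∈ Z, weight T ρ := by
    rw [Finset.sum_erase_add _ _ (Finset.mem_erase.2 ⟨hσσ'.symm, hσ'⟩),
      Finset.sum_erase_add _ _ hσ]
  have hpos : ∀ ρ : MTup S, 0 < weight T ρ := fun _ => Nat.succ_pos _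
  -- Only an inequality, because a new m-tuple may already be present in the rest of the table.
  have hins : ∀ (Y : Finset (MTup S)) ρ,
      ∑ x ∈ insert ρ Y, weight T x ≤ ∑ x ∈ Y, weight T x + weight T ρ := by
    intro Y ρ
    by_cases hρ : ρ ∈ Y
    · rw [Finset.insert_eq_of_mem hρ]; omega
    · rw [Finset.sum_insert hρ]; omega
  have hdef : mChaseRule (Z : Set (MTup S)) σ σ' A =
      if τ.Le τ' then ((Z : Set (MTup S)) \ {σ, σ'}) ∪ {τ'}
      else if τ'.Le τ then ((Z : Set (MTup S)) \ {σ, σ'}) ∪ {τ}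
      else ((Z : Set (MTup S)) \ {σ, σ'}) ∪ {τ, τ'} := rfl
  rw [hdef, hYc] at hne hinv ⊢
  rw [tableWeight_coe, ← hsum]
  have hp := hpos σ
  have hp' := hpos σ'
  split_ifs at hne hinv ⊢ with h1 h2
  · have e : (Y : Set (MTup S)) ∪ {τ'} = ((insert τ' Y : Finset (MTup S)) : Set (MTup S)) := by
      simp
    rw [e, tableWeight_coe]
    have := hins Y τ'
    have := weight_le hT hle'
    omega
  · have e : (Y : Set (MTup S)) ∪ {τ} = ((insert τ Y : Finset (MTup S)) : Set (MTup S)) := by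
      simp
    rw [e, tableWeight_coe]
    have := hins Y τ
    have := weight_le hT hle
    omega
  · have e : (Y : Set (MTup S)) ∪ {τ, τ'} =
        ((insert τ (insert τ' Y) : Finset (MTup S)) : Set (MTup S)) := by
      ext ρ
      simp only [Set.mem_union, Finset.mem_coe, Set.mem_insert_iff, Set.mem_singleton_iff,
        Finset.mem_insert]
      tauto
    have i1 := hins (insert τ' Y) τ
    have i2 := hins Y τ'
    have i3 := weight_le hT hle
    have i4 := weight_le hT hle'
    have i5 : weight T τ < weight T σ ∨ weight T τ' < weight T σ' := by
      by_cases hc : τ = σ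
      · refine Or.inr (weight_lt hT hle' (fun hc' => hne ?_)
          (hinv.sound τ' (by simp)).subset_adom)
        rw [hc, hc', ← hYc, Set.sdiff_union_self, Set.union_eq_left]
        rintro _ (rfl | rfl)
        · exact hσ
        · exact hσ'
      · exact Or.inl (weight_lt hT hle hc (hinv.sound τ (by simp)).subset_adom)
    rw [e, tableWeight_coe]
    omega

theorem exists_chase_output {T : Set (Tup S)} (hT : Admissible T) :
    ∀ (n : ℕ) (Sig : Set (MTup S)), ChaseInv T Sig → tableWeight T Sig = n →
      ∃ Sig', Relation.ReflTransGen MChaseStep Sig Sig' ∧ ∀ Sig'', ¬ MChaseStep Sig' Sig'' := by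
  intro n
  induction n using Nat.strong_induction_on with
  | _ n ih =>
    rintro Sig h rfl
    by_cases hfix : ∀ Sig'', ¬ MChaseStep Sig Sig''
    · exact ⟨Sig, .refl, hfix⟩
    · push Not at hfix
      obtain ⟨Sig₁, h₁⟩ := hfix
      obtain ⟨Sig', h2, h3⟩ := ih _ (tableWeight_lt hT h h₁) Sig₁ (h.step h₁) rfl
      exact ⟨Sig', .head h₁ h2, h3⟩

theorem exists_enumeratesMChase {T : Set (Tup S)} (hT : Admissible T) :
    ∃ l, EnumeratesMChase T l := by
  obtain ⟨Sig, h, hfix⟩ := exists_chase_output hT _ _ (chaseInv_init hT) rfl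
  have hfin := ((chaseInv_init hT).reflTransGen h).finite
  refine ⟨hfin.toFinset.toList, Finset.nodup_toList _, ?_⟩
  have e : {σ | σ ∈ hfin.toFinset.toList} = Sig := by ext σ; simp
  rw [e]
  exact ⟨h, hfix⟩

/-! ### Aggregates of lists -/

/-- The aggregate of a list of values, computed as in the procedure. -/
noncomputable def Aggr.ofList (op : Aggr) (vs : List ℝ) : Option ℝ :=
  vs.foldl op.add (procInit op).pmin

theorem Aggr.ofList_count (vs : List ℝ) : Aggr.count.ofList vs = some (vs.length : ℝ) := by
  have h : ∀ (vs : List ℝ) (x : ℝ), vs.foldl Aggr.count.add (some x) = some (x + vs.length) := by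
    intro vs
    induction vs with
    | nil => simp
    | cons v vs ih =>
      intro x
      simp only [List.foldl_cons, List.length_cons, Aggr.add, ih]
      push_cast
      congr 1
      ring
  exact (h vs 0).trans (by rw [zero_add])

theorem Aggr.ofList_nil {op : Aggr} (h : op ≠ .count) : op.ofList [] = none := by
  cases op <;> first | rfl | exact absurd rfl h

theorem Aggr.ofList_sum {vs : List ℝ} (hvs : vs ≠ []) : Aggr.sum.ofList vs = some vs.sum := by
  have h : ∀ (vs : List ℝ) (x : ℝ), vs.foldl Aggr.sum.add (some x) = some (x + vs.sum) := by
    intro vs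
    induction vs with
    | nil => simp
    | cons v vs ih =>
      intro x
      simp only [List.foldl_cons, List.sum_cons, Aggr.add, ih, add_assoc]
  cases vs with
  | nil => exact absurd rfl hvs
  | cons v vs => exact h vs v

theorem Aggr.ofList_min {vs : List ℝ} (hvs : vs ≠ []) :
    ∃ x, Aggr.min.ofList vs = some x ∧ IsLeast {v | v ∈ vs} x := by
  have h : ∀ (vs : List ℝ) (x : ℝ),
      ∃ y, vs.foldl Aggr.min.add (some x) = some y ∧ IsLeast {v | v ∈ x :: vs} y := by
    intro vs
    induction vs with
    | nil => intro x; exact ⟨x, rfl, by simp [IsLeast, lowerBounds]⟩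
    | cons v vs ih =>
      intro x
      obtain ⟨y, hy, hmem, hle⟩ := ih (Min.min x v)
      have hm : y ≤ Min.min x v := hle (List.mem_cons_self ..)
      refine ⟨y, hy, ?_, ?_⟩
      · rcases List.mem_cons.1 hmem with h | h
        · rcases min_choice x v with h' | h' <;> simp [h, h']
        · exact List.mem_cons_of_mem _ (List.mem_cons_of_mem _ h)
      · intro w hw
        rcases List.mem_cons.1 hw with rfl | hw
        · exact hm.trans (min_le_left _ _)
        rcases List.mem_cons.1 hw with rfl | hw
        · exact hm.trans (min_le_right _ _)
        · exact hle (List.mem_cons_of_mem _ hw)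
  cases vs with
  | nil => exact absurd rfl hvs
  | cons v vs => exact h vs v

theorem Aggr.ofList_max {vs : List ℝ} (hvs : vs ≠ []) :
    ∃ x, Aggr.max.ofList vs = some x ∧ IsGreatest {v | v ∈ vs} x := by
  have h : ∀ (vs : List ℝ) (x : ℝ),
      ∃ y, vs.foldl Aggr.max.add (some x) = some y ∧ IsGreatest {v | v ∈ x :: vs} y := by
    intro vs
    induction vs with
    | nil => intro x; exact ⟨x, rfl, by simp [IsGreatest, upperBounds]⟩
    | cons v vs ih =>
      intro x
      obtain ⟨y, hy, hmem, hle⟩ := ih (Max.max x v)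
      have hm : Max.max x v ≤ y := hle (List.mem_cons_self ..)
      refine ⟨y, hy, ?_, ?_⟩
      · rcases List.mem_cons.1 hmem with h | h
        · rcases max_choice x v with h' | h' <;> simp [h, h']
        · exact List.mem_cons_of_mem _ (List.mem_cons_of_mem _ h)
      · intro w hw
        rcases List.mem_cons.1 hw with rfl | hw
        · exact (le_max_left _ _).trans hm
        rcases List.mem_cons.1 hw with rfl | hw
        · exact (le_max_right _ _).trans hm
        · exact hle (List.mem_cons_of_mem _ hw)
  cases vs with
  | nil => exact absurd rfl hvs
  | cons v vs => exact h vs v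

open Classical in
/-- The values of `f` at the members of a list that satisfy `p`. -/
noncomputable def collect {α β : Type*} (l : List α) (p : α → Prop) (f : α → β) : List β :=
  (l.filter p).map f

section Collect

variable {α β : Type*} {l : List α} {p p' : α → Prop} {f f' : α → β}

theorem mem_collect {b : β} : b ∈ collect l p f ↔ ∃ a ∈ l, p a ∧ f a = b := by
  simp [collect, and_assoc]

open Classical in
theorem collect_cons (a : α) :
    collect (a :: l) p f = (if p a then [f a] else []) ++ collect l p f := by
  by_cases h : p a <;> simp [collect, h]

theorem collect_ne_nil (h : ∃ a ∈ l, p a) : collect l p f ≠ [] := by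
  obtain ⟨a, ha, hp⟩ := h
  exact List.ne_nil_of_mem (mem_collect.2 ⟨a, ha, hp, rfl⟩)

theorem collect_eq_nil (h : ∀ a ∈ l, ¬ p a) : collect l p f = [] :=
  List.eq_nil_iff_forall_not_mem.2 fun _ hb => by
    obtain ⟨a, ha, hp, -⟩ := mem_collect.1 hb
    exact h a ha hp

theorem collect_map {γ : Type*} (g : γ → α) (l : List γ) :
    collect (l.map g) p f = collect l (fun c => p (g c)) fun c => f (g c) := by
  simp only [collect, List.filter_map, List.map_map, Function.comp_def]

theorem collect_congr (hp : ∀ a ∈ l, (p a ↔ p' a)) (hf : ∀ a ∈ l, p a → f a = f' a) :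
    collect l p f = collect l p' f' := by
  induction l with
  | nil => rfl
  | cons a l ih =>
    rw [collect_cons, collect_cons, ih (fun b hb => hp b (List.mem_cons_of_mem _ hb))
      fun b hb => hf b (List.mem_cons_of_mem _ hb)]
    have h1 := hp a (List.mem_cons_self ..)
    have h2 := hf a (List.mem_cons_self ..)
    by_cases h : p a
    · rw [if_pos h, if_pos (h1.1 h), h2 h]
    · rw [if_neg h, if_neg fun h' => h (h1.2 h')]

theorem length_collect_le {β' : Type*} {g : α → β'} (h : ∀ a ∈ l, p a → p' a) :
    (collect l p f).length ≤ (collect l p' g).length := by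
  classical
  rw [collect, collect, List.length_map, List.length_map, ← List.countP_eq_length_filter,
    ← List.countP_eq_length_filter]
  exact List.countP_mono_left fun a ha hp => by simpa using h a ha (by simpa using hp)

open Classical in
theorem sum_collect (f : α → ℝ) :
    (collect l p f).sum = (l.map fun a => if p a then f a else 0).sum := by
  induction l with
  | nil => rfl
  | cons a l ih =>
    rw [collect_cons, List.sum_append, ih, List.map_cons, List.sum_cons]
    by_cases h : p a <;> simp [h]

end Collect

/-- The aggregate of a set of tuples that is enumerated by a list. -/
theorem aggregate_eq_ofList {α : Type*} (op : Aggr) (M : Fin S.p) {l : List α} (hl : l.Nodup)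
    {p : α → Prop} (t : α → Tup S)
    (ht' : ∀ a ∈ l, p a → ∀ b ∈ l, p b → t a = t b → a = b) (v : α → ℝ)
    (hv' : ∀ a ∈ l, p a → t a (Attr.meas M) = some (v a)) :
    aggregate op M {x | ∃ a ∈ l, p a ∧ t a = x} = op.ofList (collect l p v) := by
  classical
  have hmem : ∀ a, a ∈ l.filter p ↔ a ∈ l ∧ p a := by simp
  have ht : ∀ a ∈ l.filter p, ∀ b ∈ l.filter p, t a = t b → a = b := fun a ha b hb =>
    ht' a ((hmem a).1 ha).1 ((hmem a).1 ha).2 b ((hmem b).1 hb).1 ((hmem b).1 hb).2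
  have hv : ∀ a ∈ l.filter p, t a (Attr.meas M) = some (v a) := fun a ha =>
    hv' a ((hmem a).1 ha).1 ((hmem a).1 ha).2
  have e : {x | ∃ a ∈ l, p a ∧ t a = x} = {x | ∃ a ∈ l.filter p, t a = x} := by
    ext x
    simp only [Set.mem_ofPred_eq, hmem, and_assoc]
  rw [e, collect]
  have hL := hl.filter (fun a => decide (p a))
  generalize l.filter (fun a => decide (p a)) = L at *
  have himg : {x | ∃ a ∈ L, t a = x} = t '' (L.toFinset : Set α) := by
    ext x; simp
  -- Different list entries give different tuples, so `count` and `sum` over the set have the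
  -- multiplicities of the list.
  have hinj : Set.InjOn t (L.toFinset : Set α) := fun a ha b hb h =>
    ht a (by simpa using ha) b (by simpa using hb) h
  by_cases hop : op = .count
  · subst hop
    rw [Aggr.ofList_count, List.length_map, aggregate, himg, hinj.ncard_image,
      Set.ncard_coe_finset, List.toFinset_card_of_nodup hL]
  by_cases hnil : L = []
  · subst hnil
    rw [List.map_nil, Aggr.ofList_nil hop]
    cases op <;> simp [aggregate] at hop ⊢
  have hne : {x | ∃ a ∈ L, t a = x} ≠ ∅ := by
    obtain ⟨a, ha⟩ := List.exists_mem_of_ne_nil L hnil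
    exact Set.Nonempty.ne_empty ⟨t a, a, ha, rfl⟩
  have hvs : L.map v ≠ [] := by simpa using hnil
  have hset : {w : ℝ | ∃ x ∈ {x | ∃ a ∈ L, t a = x}, x (Attr.meas M) = some w} =
      {w | w ∈ L.map v} := by
    ext w
    simp only [Set.mem_ofPred_eq, List.mem_map]
    constructor
    · rintro ⟨_, ⟨a, ha, rfl⟩, hw⟩
      exact ⟨a, ha, Option.some.inj ((hv a ha).symm.trans hw)⟩
    · rintro ⟨a, ha, rfl⟩
      exact ⟨_, ⟨a, ha, rfl⟩, hv a ha⟩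
  cases op with
  | count => exact absurd rfl hop
  | min =>
    obtain ⟨x, hx, hl⟩ := Aggr.ofList_min hvs
    rw [hx]
    simp only [aggregate]
    rw [if_neg hne, hset, hl.csInf_eq]
  | max =>
    obtain ⟨x, hx, hl⟩ := Aggr.ofList_max hvs
    rw [hx]
    simp only [aggregate]
    rw [if_neg hne, hset, hl.csSup_eq]
  | sum =>
    rw [Aggr.ofList_sum hvs]
    simp only [aggregate]
    rw [if_neg hne, himg, finsum_mem_image hinj, finsum_mem_coe_finset,
      List.sum_toFinset _ hL]
    congr 2
    refine List.map_congr_left fun a ha => ?_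
    rw [hv a ha]; rfl

/-! ### The procedure -/

namespace AnalyticQuery

variable (q : AnalyticQuery S) (T : Set (Tup S)) (part : Attr S → Cond S)

/-- The least candidate value of an m-tuple. -/
noncomputable def minVal (σ : MTup S) : ℝ := sInf (q.candidates T part σ)

/-- The greatest candidate value of an m-tuple. -/
noncomputable def maxVal (σ : MTup S) : ℝ := sSup (q.candidates T part σ)

/-- The m-tuples that contribute to the lower bound. -/
def InLow (σ : MTup S) : Prop :=
  q.Relevant T σ ∧ (q.Certain T σ ∨ q.aggr = .min ∨ q.aggr = .sum ∧ q.minVal T part σ < 0)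

/-- The m-tuples that contribute to the upper bound. -/
def InHigh (σ : MTup S) : Prop :=
  q.Relevant T σ ∧ (q.Certain T σ ∨ q.aggr = .max ∨ q.aggr = .count ∨
    q.aggr = .sum ∧ 0 < q.maxVal T part σ)

/-- The m-tuples that contribute to the strongly consistent answer. -/
def InStrong (σ : MTup S) : Prop :=
  q.Relevant T σ ∧ q.Certain T σ ∧ ∃ m₀ : ℝ, σ (Attr.meas q.M) = {m₀}

/-- Lets the increment of `count` at m-tuples that are not certain be written with `maxVal`, as for
the other operators. -/
theorem add_count (acc : Option ℝ) (v w : ℝ) : Aggr.count.add acc v = Aggr.count.add acc w := by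
  cases acc <;> rfl

theorem procStep_change (st : ProcState) (σ : MTup S) :
    (q.procStep T part st σ).change = true ↔
      st.change = true ∨ q.Relevant T σ ∧ q.Certain T σ := by
  obtain ⟨op, M, Γ⟩ := q
  unfold procStep
  simp only
  by_cases h1 : (⟨op, M, Γ⟩ : AnalyticQuery S).Relevant T σ
  · by_cases h2 : (⟨op, M, Γ⟩ : AnalyticQuery S).Certain T σ
    · simp [h1, h2]
    · cases op <;> simp [h1, h2]
  · simp [h1]

open Classical in
theorem procStep_pmin (st : ProcState) (σ : MTup S) :
    (q.procStep T part st σ).pmin =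
      if q.InLow T part σ then q.aggr.add st.pmin (q.minVal T part σ) else st.pmin := by
  obtain ⟨op, M, Γ⟩ := q
  unfold procStep InLow
  simp only
  by_cases h1 : (⟨op, M, Γ⟩ : AnalyticQuery S).Relevant T σ
  · by_cases h2 : (⟨op, M, Γ⟩ : AnalyticQuery S).Certain T σ
    · simp [h1, h2, minVal]
    · cases op <;> simp [h1, h2, minVal]
  · simp [h1]

open Classical in
theorem procStep_pmax (st : ProcState) (σ : MTup S) :
    (q.procStep T part st σ).pmax =
      if q.InHigh T part σ then q.aggr.add st.pmax (q.maxVal T part σ) else st.pmax := by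
  obtain ⟨op, M, Γ⟩ := q
  unfold procStep InHigh
  simp only
  by_cases h1 : (⟨op, M, Γ⟩ : AnalyticQuery S).Relevant T σ
  · by_cases h2 : (⟨op, M, Γ⟩ : AnalyticQuery S).Certain T σ
    · simp [h1, h2, maxVal]
    · cases op
      · simp [h1, h2, maxVal]
      · simp [h1, h2, maxVal]
      · simp [h1, h2, maxVal]
      · simp [h1, h2, maxVal]
        exact add_count _ _ _
  · simp [h1]

-- On a singleton the infimum is its element, so `sInf` replaces the `m₀` of the procedure by a
-- function defined at every m-tuple.
open Classical in
theorem procStep_pans (st : ProcState) (σ : MTup S) :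
    (q.procStep T part st σ).pans =
      if q.InStrong T σ then q.aggr.add st.pans (sInf (σ (Attr.meas q.M))) else st.pans := by
  obtain ⟨op, M, Γ⟩ := q
  unfold procStep InStrong
  simp only
  by_cases h1 : (⟨op, M, Γ⟩ : AnalyticQuery S).Relevant T σ
  · by_cases h2 : (⟨op, M, Γ⟩ : AnalyticQuery S).Certain T σ
    · by_cases h3 : ∃ m₀ : ℝ, σ (Attr.meas M) = {m₀}
      · rw [if_pos h1, if_pos h2, if_pos ⟨h1, h2, h3⟩]
        simp only [dif_pos h3]
        congr 1
        conv_rhs => rw [h3.choose_spec]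
        exact (csInf_singleton _).symm
      · rw [if_pos h1, if_pos h2, if_neg (fun h => h3 h.2.2)]
        simp only [dif_neg h3]
    · cases op <;> simp [h1, h2]
  · simp [h1]

-- The accumulators do not influence one another. Each can be followed alone, as the fold of one
-- operation over the values of the m-tuples that affect it.
open Classical in
theorem foldl_collect {α : Type*} (step : ProcState → α → ProcState)
    (f : ProcState → Option ℝ) (op : Aggr) (p : α → Prop) (v : α → ℝ)
    (h : ∀ st a, f (step st a) = if p a then op.add (f st) (v a) else f st) (l : List α)
    (st : ProcState) :
    f (l.foldl step st) = (collect l p v).foldl op.add (f st) := by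
  induction l generalizing st with
  | nil => rfl
  | cons a l ih =>
    rw [List.foldl_cons, ih, h, collect_cons, List.foldl_append]
    by_cases hp : p a <;> simp [hp]

theorem procInit_pmax (op : Aggr) : (procInit op).pmax = (procInit op).pmin := by cases op <;> rfl

theorem procInit_pans (op : Aggr) : (procInit op).pans = (procInit op).pmin := by cases op <;> rfl

theorem computeAggregate_pmin (l : List (MTup S)) : (q.computeAggregate T part l).pmin =
    q.aggr.ofList (collect l (q.InLow T part) (q.minVal T part)) :=
  foldl_collect _ ProcState.pmin q.aggr _ _ (q.procStep_pmin T part) l _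

theorem computeAggregate_pmax (l : List (MTup S)) : (q.computeAggregate T part l).pmax =
    q.aggr.ofList (collect l (q.InHigh T part) (q.maxVal T part)) := by
  rw [Aggr.ofList, ← procInit_pmax]
  exact foldl_collect _ ProcState.pmax q.aggr _ _ (q.procStep_pmax T part) l _

theorem computeAggregate_pans (l : List (MTup S)) : (q.computeAggregate T part l).pans =
    q.aggr.ofList (collect l (q.InStrong T) fun σ => sInf (σ (Attr.meas q.M))) := by
  rw [Aggr.ofList, ← procInit_pans]
  exact foldl_collect _ ProcState.pans q.aggr _ _ (q.procStep_pans T part) l _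

theorem computeAggregate_change (l : List (MTup S)) :
    (q.computeAggregate T part l).change = true ↔
      ∃ σ ∈ l, q.Relevant T σ ∧ q.Certain T σ := by
  have h : ∀ (l : List (MTup S)) st, (l.foldl (q.procStep T part) st).change = true ↔
      st.change = true ∨ ∃ σ ∈ l, q.Relevant T σ ∧ q.Certain T σ := by
    intro l
    induction l with
    | nil => simp
    | cons σ l ih =>
      intro st
      rw [List.foldl_cons, ih, procStep_change]
      simp only [List.mem_cons, exists_eq_or_imp, or_assoc]
  rw [computeAggregate, h]
  cases q.aggr <;> simp [procInit]

end AnalyticQuery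

/-! ### Independent conditions -/

/-- The value `v` of the attribute `A` satisfies the part of an independent condition on `A`. -/
def Fits (T : Set (Tup S)) (part : Attr S → Cond S) (A : Attr S) (v : A.dom) : Prop :=
  ∀ t : Tup S, t A = some v → t.restrict {A} ∈ (part A).Sat T

theorem restrict_singleton_mem_sat {T : Set (Tup S)} {part : Attr S → Cond S} {A : Attr S}
    {v : A.dom} {t : Tup S} (ht : t A = some v) :
    t.restrict {A} ∈ (part A).Sat T ↔ Fits T part A v := by
  refine ⟨fun h s hs => ?_, fun h => h t ht⟩
  have : s.restrict {A} = t.restrict {A} := by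
    refine Tup.ext fun B b => ?_
    rw [Tup.restrict_eq_some, Tup.restrict_eq_some]
    refine and_congr_right ?_
    rintro rfl
    rw [hs, ht]
  rwa [this]

/-- The form in which independence is used: values can be tested, and therefore chosen, one
attribute at a time. -/
theorem Cond.IndependentVia.mem_sat_iff {T : Set (Tup S)} {Γ : Cond S} {part : Attr S → Cond S}
    (hΓ : Γ.IndependentVia T part) {t : Tup S} (ht : t ∈ discourse T Γ.sch) :
    t ∈ Γ.Sat T ↔ ∀ A ∈ Γ.sch, ∀ v, t A = some v → Fits T part A v := by
  rw [hΓ.sat_iff t ht]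
  refine forall₂_congr fun A hA => ?_
  obtain ⟨a, ha⟩ := Tup.mem_sch.1 (ht.1.symm ▸ hA : A ∈ t.sch)
  rw [restrict_singleton_mem_sat ha, ha]
  simp

theorem exists_mem_tuples (σ : MTup S) {A : Attr S} {v : A.dom} (hv : v ∈ σ A) :
    ∃ t ∈ σ.tuples, t A = some v := by
  classical
  let u : (B : Attr S) → Option B.dom := fun B => if h : (σ B).Nonempty then some h.some else none
  have hu : ∀ B b, u B = some b → b ∈ σ B := by
    intro B b h
    simp only [u] at h
    split_ifs at h with h'
    rw [← Option.some.inj h]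
    exact h'.some_mem
  let w : Tup S := fun B => Function.update u A (some v) B
  have hw : w A = some v := Function.update_self ..
  have hw' : ∀ B, B ≠ A → w B = u B := fun B hB => Function.update_of_ne hB ..
  refine ⟨w, ⟨?_, ?_⟩, hw⟩
  · ext B
    rw [Tup.mem_sch, MTup.mem_sch]
    by_cases hB : B = A
    · subst hB
      exact ⟨fun _ => ⟨v, hv⟩, fun _ => ⟨v, hw⟩⟩
    · rw [hw' B hB]
      exact ⟨fun ⟨b, hb⟩ => ⟨b, hu B b hb⟩, fun h => ⟨h.some, dif_pos h⟩⟩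
  · intro B b h
    by_cases hB : B = A
    · subst hB
      rw [hw] at h
      exact Option.some.inj h ▸ hv
    · rw [hw' B hB] at h
      exact hu B b h

theorem tuples_subset_discourse {T : Set (Tup S)} {s : Tup S} {X : Set (Attr S)}
    (hX : X ⊆ (values T s).sch) : ((values T s).restrict X).tuples ⊆ discourse T X := by
  rintro t ⟨ht, htσ⟩
  refine ⟨ht.trans (Set.ext fun A => ?_), fun A a h => values_subset_adom T s A (htσ A a h).1⟩
  exact ⟨fun ⟨a, _, hA⟩ => hA, fun hA => (hX hA).imp fun a ha => ⟨ha, hA⟩⟩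

namespace AnalyticQuery

variable {q : AnalyticQuery S} {T : Set (Tup S)} {part : Attr S → Cond S}

theorem keys_subset_sch : keys S ⊆ q.sch := fun _ h => Or.inl (Or.inl h)

theorem meas_mem_sch : Attr.meas q.M ∈ q.sch := Or.inl (Or.inr rfl)

theorem sch_subset_sch : q.Γ.sch ⊆ q.sch := fun _ h => Or.inr h

theorem mem_candidates {σ : MTup S} {v : ℝ} :
    v ∈ q.candidates T part σ ↔
      v ∈ σ (Attr.meas q.M) ∧ (Attr.meas q.M ∈ q.Γ.sch → Fits T part (Attr.meas q.M) v) := by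
  constructor
  · rintro ⟨t, ⟨ht, htσ⟩, htv, hf⟩
    refine ⟨(htσ (Attr.meas q.M) v htv).1, fun hM => ?_⟩
    have : t.restrict {Attr.meas q.M} = t := by
      refine Tup.ext fun B b => ?_
      rw [Tup.restrict_eq_some]
      exact ⟨fun h => h.2, fun h => ⟨(htσ B b h).2, h⟩⟩
    rw [← restrict_singleton_mem_sat htv, this]
    exact hf hM
  · rintro ⟨hv, hf⟩
    obtain ⟨t, ht, htv⟩ := exists_mem_tuples (σ.restrict {Attr.meas q.M})
      (A := Attr.meas q.M) (v := v) ⟨hv, rfl⟩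
    refine ⟨t, ht, htv, fun hM => ?_⟩
    have : t.restrict {Attr.meas q.M} = t := by
      refine Tup.ext fun B b => ?_
      rw [Tup.restrict_eq_some]
      exact ⟨fun h => h.2, fun h => ⟨(ht.2 B b h).2, h⟩⟩
    rw [← this]
    exact hf hM t htv

theorem Relevant.exists_fits (hΓ : q.Γ.IndependentVia T part) {s : Tup S}
    (h : q.Relevant T (values T s)) {A : Attr S} (hA : A ∈ q.Γ.sch) :
    ∃ v ∈ values T s A, Fits T part A v := by
  obtain ⟨hsch, t, ht, hsat⟩ := h
  have hd := tuples_subset_discourse (sch_subset_sch.trans hsch) ht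
  obtain ⟨v, hv⟩ := Tup.mem_sch.1 (hd.1.symm ▸ hA : A ∈ t.sch)
  exact ⟨v, (ht.2 A v hv).1, (hΓ.mem_sat_iff hd).1 hsat A hA v hv⟩

theorem Relevant.candidates_nonempty (hΓ : q.Γ.IndependentVia T part) {s : Tup S}
    (h : q.Relevant T (values T s)) : (q.candidates T part (values T s)).Nonempty := by
  by_cases hM : Attr.meas q.M ∈ q.Γ.sch
  · obtain ⟨v, hv, hf⟩ := h.exists_fits hΓ hM
    exact ⟨v, mem_candidates.2 ⟨hv, fun _ => hf⟩⟩
  · obtain ⟨v, hv⟩ := h.1 meas_mem_sch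
    exact ⟨v, mem_candidates.2 ⟨hv, fun h => absurd h hM⟩⟩

/-- Any value at any attribute extends to a tuple of the m-tuple, so a single bad value already
destroys certainty. -/
theorem certain_iff (hΓ : q.Γ.IndependentVia T part) {s : Tup S}
    (h : q.sch ⊆ (values T s).sch) : q.Certain T (values T s) ↔
      ∀ A ∈ q.Γ.sch, ∀ v ∈ values T s A, Fits T part A v := by
  have hd := tuples_subset_discourse (T := T) (sch_subset_sch.trans h)
  constructor
  · intro hc A hA v hv
    obtain ⟨t, ht, htv⟩ := exists_mem_tuples ((values T s).restrict q.Γ.sch)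
      (A := A) (v := v) ⟨hv, hA⟩
    exact (hΓ.mem_sat_iff (hd ht)).1 (hc ht) A hA v htv
  · intro hf t ht
    exact (hΓ.mem_sat_iff (hd ht)).2 fun A hA v hv => hf A hA v (ht.2 A v hv).1

theorem candidates_finite (hT : Admissible T) (s : Tup S) :
    (q.candidates T part (values T s)).Finite :=
  (values_finite hT s _).subset fun _ hv => (mem_candidates.1 hv).1

theorem candidates_of_certain (hΓ : q.Γ.IndependentVia T part) {s : Tup S}
    (h : q.sch ⊆ (values T s).sch) (hc : q.Certain T (values T s)) :
    q.candidates T part (values T s) = values T s (Attr.meas q.M) := by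
  ext v
  rw [mem_candidates]
  exact ⟨fun h => h.1, fun hv => ⟨hv, fun hM => (certain_iff hΓ h).1 hc _ hM v hv⟩⟩

/-! ### The tuples that a choice selects -/

/-- The choice `c` satisfies the condition of the query at `s`. -/
def Picks (q : AnalyticQuery S) (T : Set (Tup S)) (c : Tup S → Tup S) (s : Tup S) : Prop :=
  q.sch ⊆ (values T s).sch ∧ (c s).restrict q.Γ.sch ∈ q.Γ.Sat T

/-- The measure value that the choice `c` picks at `s`. -/
noncomputable def pickedVal (q : AnalyticQuery S) (c : Tup S → Tup S) (s : Tup S) : ℝ :=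
  Option.getD (α := ℝ) (c s (Attr.meas q.M)) 0

end AnalyticQuery

theorem IsChoice.sch_eq {T : Set (Tup S)} {c : Tup S → Tup S} (hc : IsChoice T c) (s : Tup S) :
    (c s).sch = (values T s).sch := by
  ext A
  exact ⟨fun h => (Tup.mem_sch.1 h).imp fun a ha => hc.mem s A a ha, fun h => hc.dfd s A h⟩

theorem IsChoice.restrict_mem_tuples {T : Set (Tup S)} {c : Tup S → Tup S} (hc : IsChoice T c)
    (s : Tup S) (X : Set (Attr S)) :
    (c s).restrict X ∈ ((values T s).restrict X).tuples := by
  refine ⟨?_, fun A a h => ?_⟩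
  · rw [Tup.sch_restrict, hc.sch_eq]
    ext A
    exact ⟨fun ⟨hA, a, ha⟩ => ⟨a, ha, hA⟩, fun ⟨a, ha, hA⟩ => ⟨hA, a, ha⟩⟩
  · obtain ⟨hA, h⟩ := Tup.restrict_eq_some.1 h
    exact ⟨hc.mem s A a h, hA⟩

namespace AnalyticQuery

variable {q : AnalyticQuery S} {T : Set (Tup S)} {part : Attr S → Cond S} {c : Tup S → Tup S}

theorem picks_iff (hΓ : q.Γ.IndependentVia T part) (hc : IsChoice T c) {s : Tup S}
    (h : q.sch ⊆ (values T s).sch) :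
    q.Picks T c s ↔ ∀ A ∈ q.Γ.sch, ∀ v, c s A = some v → Fits T part A v := by
  have hd := tuples_subset_discourse (sch_subset_sch.trans h) (hc.restrict_mem_tuples s q.Γ.sch)
  rw [Picks, hΓ.mem_sat_iff hd]
  constructor
  · rintro ⟨-, h'⟩ A hA v hv
    exact h' A hA v (Tup.restrict_eq_some.2 ⟨hA, hv⟩)
  · exact fun h' => ⟨h, fun A hA v hv => h' A hA v (Tup.restrict_eq_some.1 hv).2⟩

theorem Picks.relevant (hc : IsChoice T c) {s : Tup S} (h : q.Picks T c s) :
    q.Relevant T (values T s) :=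
  ⟨h.1, _, hc.restrict_mem_tuples s _, h.2⟩

theorem Certain.picks (hc : IsChoice T c) {s : Tup S} (h : q.Relevant T (values T s))
    (hcert : q.Certain T (values T s)) : q.Picks T c s :=
  ⟨h.1, hcert (hc.restrict_mem_tuples s _)⟩

theorem Picks.apply_meas (hc : IsChoice T c) {s : Tup S} (h : q.Picks T c s) :
    c s (Attr.meas q.M) = some (q.pickedVal c s) := by
  obtain ⟨v, hv⟩ := Tup.mem_sch.1 (hc.dfd s _ (h.1 meas_mem_sch))
  rw [pickedVal, hv]
  rfl

theorem Picks.mem_candidates (hΓ : q.Γ.IndependentVia T part) (hc : IsChoice T c) {s : Tup S}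
    (h : q.Picks T c s) : q.pickedVal c s ∈ q.candidates T part (values T s) :=
  AnalyticQuery.mem_candidates.2 ⟨hc.mem s _ _ (h.apply_meas hc),
    fun hM => (picks_iff hΓ hc h.1).1 h _ hM _ (h.apply_meas hc)⟩

theorem Picks.minVal_le (hT : Admissible T) (hΓ : q.Γ.IndependentVia T part) (hc : IsChoice T c)
    {s : Tup S} (h : q.Picks T c s) : q.minVal T part (values T s) ≤ q.pickedVal c s :=
  csInf_le (candidates_finite hT s).bddBelow (h.mem_candidates hΓ hc)

theorem Picks.le_maxVal (hT : Admissible T) (hΓ : q.Γ.IndependentVia T part) (hc : IsChoice T c)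
    {s : Tup S} (h : q.Picks T c s) : q.pickedVal c s ≤ q.maxVal T part (values T s) :=
  le_csSup (candidates_finite hT s).bddAbove (h.mem_candidates hΓ hc)

/-- Some choice satisfies the condition wherever possible, with prescribed candidate values. -/
theorem exists_favorable_choice (hT : Admissible T) (hΓ : q.Γ.IndependentVia T part)
    (e : Set ℝ → ℝ) (he : ∀ X : Set ℝ, X.Finite → X.Nonempty → e X ∈ X) :
    ∃ c, IsChoice T c ∧ ∀ s, q.Relevant T (values T s) →
      q.Picks T c s ∧ q.pickedVal c s = e (q.candidates T part (values T s)) := by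
  -- The preference reads only the attribute and its value set `X`, so it respects agreement of
  -- tuples. Only fitting values are preferred; at the measure `q.M` the preferred one is `e` of the
  -- candidates. The case distinction on `A` makes `X` a set of reals there.
  let P : (A : Attr S) → Set A.dom → Set A.dom := fun A X =>
    match A, X with
    | .key i, _ => {v | Attr.key i ∈ q.Γ.sch → Fits T part (.key i) v}
    | .dim i j, _ => {v | Attr.dim i j ∈ q.Γ.sch → Fits T part (.dim i j) v}
    | .meas k, X => {v : ℝ | (Attr.meas k ∈ q.Γ.sch → Fits T part (.meas k) v) ∧
        (k = q.M → v = e {w : ℝ | w ∈ X ∧ (Attr.meas k ∈ q.Γ.sch → Fits T part (.meas k) w)})}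
  obtain ⟨c, hc, hcP⟩ := exists_isChoice T (fun s A => P A (values T s A))
    fun s s' A h => by simp only [values_congr T h]
  refine ⟨c, hc, fun s hs => ?_⟩
  have hcand : {w : ℝ | w ∈ values T s (Attr.meas q.M) ∧
      (Attr.meas q.M ∈ q.Γ.sch → Fits T part (.meas q.M) w)} =
        q.candidates T part (values T s) := by
    ext w; exact mem_candidates.symm
  have hemem := he _ (candidates_finite hT s) (hs.candidates_nonempty hΓ)
  have hP : ∀ A ∈ q.Γ.sch, ∀ v, v ∈ P A (values T s A) → Fits T part A v := by
    rintro (i | ⟨i, j⟩ | k) hA v hv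
    · exact hv hA
    · exact hv hA
    · exact hv.1 hA
  have hM : c s (Attr.meas q.M) = some (e (q.candidates T part (values T s))) := by
    have h1 := AnalyticQuery.mem_candidates.1 hemem
    obtain ⟨v, hv, hcv⟩ := hcP s (Attr.meas q.M) ⟨_, h1.1, h1.2, fun _ => by rw [hcand]⟩
    rw [hcv, ← hcand, ← hv.2 rfl]
  have hpicks : q.Picks T c s := by
    rw [picks_iff hΓ hc hs.1]
    intro A hA v hv
    have hne : (values T s A ∩ P A (values T s A)).Nonempty := by
      obtain ⟨w, hw, hf⟩ := hs.exists_fits hΓ hA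
      match A, hA, w, hw, hf with
      | .key i, hA, w, hw, hf => exact ⟨w, hw, fun _ => hf⟩
      | .dim i j, hA, w, hw, hf => exact ⟨w, hw, fun _ => hf⟩
      | .meas k, hA, w, hw, hf =>
        by_cases hk : k = q.M
        · subst hk
          have h1 := AnalyticQuery.mem_candidates.1 hemem
          exact ⟨_, h1.1, h1.2, fun _ => by rw [hcand]⟩
        · exact ⟨w, hw, fun _ => hf, fun h => absurd h hk⟩
    obtain ⟨w, hw, hcw⟩ := hcP s A hne
    rw [hcw] at hv
    exact hP A hA v (Option.some.inj hv ▸ hw)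
  refine ⟨hpicks, ?_⟩
  have := hpicks.apply_meas hc
  rw [hM] at this
  exact (Option.some.inj this).symm

/-- Some choice violates the condition wherever possible, with prescribed values elsewhere. -/
theorem exists_adverse_choice (hT : Admissible T) (hΓ : q.Γ.IndependentVia T part)
    (e : Set ℝ → ℝ) (he : ∀ X : Set ℝ, X.Finite → X.Nonempty → e X ∈ X) :
    ∃ c, IsChoice T c ∧ ∀ s, q.Relevant T (values T s) →
      (q.Picks T c s ↔ q.Certain T (values T s)) ∧
      (q.Certain T (values T s) → q.pickedVal c s = e (q.candidates T part (values T s))) := by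
  -- Violating values are preferred. At a measure without any violating value, in particular one
  -- outside `q.Γ.sch`, the preferred value is `e X`. Preferences at other attributes outside
  -- `q.Γ.sch` have no effect on `Picks`.
  let P : (A : Attr S) → Set A.dom → Set A.dom := fun A X =>
    match A, X with
    | .key i, _ => {v | ¬ Fits T part (.key i) v}
    | .dim i j, _ => {v | ¬ Fits T part (.dim i j) v}
    | .meas k, X => {v : ℝ | ¬ (Attr.meas k ∈ q.Γ.sch → Fits T part (.meas k) v) ∨
        ((∀ w ∈ X, Attr.meas k ∈ q.Γ.sch → Fits T part (.meas k) w) ∧ v = e X)}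
  obtain ⟨c, hc, hcP⟩ := exists_isChoice T (fun s A => P A (values T s A))
    fun s s' A h => by simp only [values_congr T h]
  refine ⟨c, hc, fun s hs => ⟨⟨fun hp => ?_, fun h => h.picks hc hs⟩, fun hcert => ?_⟩⟩
  · rw [certain_iff hΓ hs.1]
    by_contra hcon
    push Not at hcon
    obtain ⟨A, hA, v, hv, hf⟩ := hcon
    rw [picks_iff hΓ hc hs.1] at hp
    have hne : v ∈ P A (values T s A) := by
      match A, hA, v, hv, hf with
      | .key i, hA, v, hv, hf => exact hf
      | .dim i j, hA, v, hv, hf => exact hf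
      | .meas k, hA, v, hv, hf => exact Or.inl fun h => hf (h hA)
    -- One attribute with a violating value is enough: the choice takes such a value there, and the
    -- condition fails.
    obtain ⟨w, hw, hcw⟩ := hcP s A ⟨v, hv, hne⟩
    have hfw := hp A hA w hcw
    match A, hA, v, hv, hf, w, hw, hfw with
    | .key i, hA, v, hv, hf, w, hw, hfw => exact hw hfw
    | .dim i j, hA, v, hv, hf, w, hw, hfw => exact hw hfw
    | .meas k, hA, v, hv, hf, w, hw, hfw =>
      rcases hw with hw | hw
      · exact hw fun _ => hfw
      · exact hf (hw.1 v hv hA)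
  · have hall : ∀ w ∈ values T s (Attr.meas q.M), Attr.meas q.M ∈ q.Γ.sch →
        Fits T part (.meas q.M) w := fun w hw hM => (certain_iff hΓ hs.1).1 hcert _ hM w hw
    rw [candidates_of_certain hΓ hs.1 hcert]
    obtain ⟨w, hw, hcw⟩ := hcP s (Attr.meas q.M)
      ⟨_, he _ (values_finite hT s _) (hs.1 meas_mem_sch), Or.inr ⟨hall, rfl⟩⟩
    have hwv := hc.mem _ _ _ hcw
    rw [(hcert.picks hc hs).apply_meas hc] at hcw
    rw [Option.some.inj hcw]
    rcases hw with hw | hw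
    · exact absurd (hall w hwv) hw
    · exact hw.2

end AnalyticQuery

/-! ### Comparison of aggregates -/

section Bounds

variable {α : Type*} {bs : List α} {R C J : α → Prop} {f v : α → ℝ}

/-- Here `R`, `C`, `J` stand for relevant, certain and picked, `f` for the least candidate and `v`
for the picked value. For `sum` the comparison is termwise: a picked entry left out of the bound has
`f ≥ 0`, and an entry that is counted but not picked has `f < 0`. The hypothesis `hC` keeps both
lists nonempty, so no aggregate is `none`. -/
theorem exists_ofList_low_le (op : Aggr) (hCJ : ∀ a ∈ bs, R a → C a → J a)
    (hJR : ∀ a ∈ bs, J a → R a) (hv : ∀ a ∈ bs, J a → f a ≤ v a) (hC : ∃ a ∈ bs, R a ∧ C a) :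
    ∃ x d, op.ofList (collect bs (fun a =>
        R a ∧ (C a ∨ op = .min ∨ op = .sum ∧ f a < 0)) f) = some x ∧
      op.ofList (collect bs J v) = some d ∧ x ≤ d := by
  have hlow : ∃ a ∈ bs, R a ∧ (C a ∨ op = .min ∨ op = .sum ∧ f a < 0) :=
    hC.imp fun a h => ⟨h.1, h.2.1, Or.inl h.2.2⟩
  have hJ : ∃ a ∈ bs, J a := hC.imp fun a h => ⟨h.1, hCJ a h.1 h.2.1 h.2.2⟩
  cases op with
  | count =>
    rw [Aggr.ofList_count, Aggr.ofList_count]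
    exact ⟨_, _, rfl, rfl, Nat.cast_le.2 <| length_collect_le fun a ha h =>
      hCJ a ha h.1 (h.2.resolve_right (by simp))⟩
  | min =>
    obtain ⟨x, hx, hlx⟩ := Aggr.ofList_min (collect_ne_nil (f := f) hlow)
    obtain ⟨d, hd, hld⟩ := Aggr.ofList_min (collect_ne_nil (f := v) hJ)
    refine ⟨x, d, hx, hd, ?_⟩
    obtain ⟨a, ha, hJa, rfl⟩ := mem_collect.1 hld.1
    exact (hlx.2 (mem_collect.2 ⟨a, ha, ⟨hJR a ha hJa, by simp⟩, rfl⟩)).trans (hv a ha hJa)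
  | max =>
    obtain ⟨x, hx, hlx⟩ := Aggr.ofList_max (collect_ne_nil (f := f) hlow)
    obtain ⟨d, hd, hld⟩ := Aggr.ofList_max (collect_ne_nil (f := v) hJ)
    refine ⟨x, d, hx, hd, ?_⟩
    obtain ⟨a, ha, hLa, rfl⟩ := mem_collect.1 hlx.1
    have hJa : J a := hCJ a ha hLa.1 (hLa.2.resolve_right (by simp))
    exact (hv a ha hJa).trans (hld.2 (mem_collect.2 ⟨a, ha, hJa, rfl⟩))
  | sum =>
    refine ⟨_, _, Aggr.ofList_sum (collect_ne_nil hlow), Aggr.ofList_sum (collect_ne_nil hJ),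
      ?_⟩
    rw [sum_collect, sum_collect]
    refine List.sum_le_sum fun a ha => ?_
    by_cases hJa : J a
    · have h1 := hv a ha hJa
      simp only [hJR a ha hJa, hJa, if_true, true_and]
      split_ifs with h
      · exact h1
      · push Not at h
        exact ((h (hJR a ha hJa)).2.2 rfl).trans h1
    · simp only [hJa, if_false]
      split_ifs with h
      · rcases h.2 with h' | h' | h'
        · exact absurd (hCJ a ha h.1 h') hJa
        · exact absurd h' (by simp)
        · exact h'.2.le
      · exact le_rfl

/-- The mirror image, with `f` as the greatest candidate. The asymmetry is in `count`, whose upper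
bound runs over all relevant entries. -/
theorem exists_le_ofList_high (op : Aggr) (hCJ : ∀ a ∈ bs, R a → C a → J a)
    (hJR : ∀ a ∈ bs, J a → R a) (hv : ∀ a ∈ bs, J a → v a ≤ f a) (hC : ∃ a ∈ bs, R a ∧ C a) :
    ∃ x d, op.ofList (collect bs (fun a =>
        R a ∧ (C a ∨ op = .max ∨ op = .count ∨ op = .sum ∧ 0 < f a)) f) = some x ∧
      op.ofList (collect bs J v) = some d ∧ d ≤ x := by
  have hhigh : ∃ a ∈ bs, R a ∧ (C a ∨ op = .max ∨ op = .count ∨ op = .sum ∧ 0 < f a) :=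
    hC.imp fun a h => ⟨h.1, h.2.1, Or.inl h.2.2⟩
  have hJ : ∃ a ∈ bs, J a := hC.imp fun a h => ⟨h.1, hCJ a h.1 h.2.1 h.2.2⟩
  cases op with
  | count =>
    rw [Aggr.ofList_count, Aggr.ofList_count]
    exact ⟨_, _, rfl, rfl, Nat.cast_le.2 <| length_collect_le fun a ha h => ⟨hJR a ha h, by simp⟩⟩
  | min =>
    obtain ⟨x, hx, hlx⟩ := Aggr.ofList_min (collect_ne_nil (f := f) hhigh)
    obtain ⟨d, hd, hld⟩ := Aggr.ofList_min (collect_ne_nil (f := v) hJ)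
    refine ⟨x, d, hx, hd, ?_⟩
    obtain ⟨a, ha, hLa, rfl⟩ := mem_collect.1 hlx.1
    have hJa : J a := hCJ a ha hLa.1 (hLa.2.resolve_right (by simp))
    exact (hld.2 (mem_collect.2 ⟨a, ha, hJa, rfl⟩)).trans (hv a ha hJa)
  | max =>
    obtain ⟨x, hx, hlx⟩ := Aggr.ofList_max (collect_ne_nil (f := f) hhigh)
    obtain ⟨d, hd, hld⟩ := Aggr.ofList_max (collect_ne_nil (f := v) hJ)
    refine ⟨x, d, hx, hd, ?_⟩
    obtain ⟨a, ha, hJa, rfl⟩ := mem_collect.1 hld.1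
    exact (hv a ha hJa).trans (hlx.2 (mem_collect.2 ⟨a, ha, ⟨hJR a ha hJa, by simp⟩, rfl⟩))
  | sum =>
    refine ⟨_, _, Aggr.ofList_sum (collect_ne_nil hhigh),
      Aggr.ofList_sum (collect_ne_nil hJ), ?_⟩
    rw [sum_collect, sum_collect]
    refine List.sum_le_sum fun a ha => ?_
    by_cases hJa : J a
    · have h1 := hv a ha hJa
      simp only [hJR a ha hJa, hJa, if_true, true_and]
      split_ifs with h
      · exact h1
      · push Not at h
        exact h1.trans ((h (hJR a ha hJa)).2.2.2 rfl)
    · simp only [hJa, if_false]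
      split_ifs with h
      · rcases h.2 with h' | h' | h' | h'
        · exact absurd (hCJ a ha h.1 h') hJa
        · exact absurd h' (by simp)
        · exact absurd h' (by simp)
        · exact h'.2.le
      · exact le_rfl

/-- For sums of nonnegative values, restricting to nonzero values outside `C` changes nothing. -/
theorem ofList_sum_pos (hf : ∀ a ∈ bs, R a → 0 ≤ f a) (hC : ∃ a ∈ bs, R a ∧ C a) :
    Aggr.sum.ofList (collect bs (fun a => R a ∧ (C a ∨ 0 < f a)) f) =
      Aggr.sum.ofList (collect bs R f) := by
  rw [Aggr.ofList_sum (collect_ne_nil (p := fun a => R a ∧ (C a ∨ 0 < f a))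
      (hC.imp fun a h => ⟨h.1, h.2.1, Or.inl h.2.2⟩)),
    Aggr.ofList_sum (collect_ne_nil (hC.imp fun a h => ⟨h.1, h.2.1⟩)),
    sum_collect, sum_collect]
  congr 2
  refine List.map_congr_left fun a ha => ?_
  by_cases hR : R a
  · simp only [hR, true_and, if_true]
    split_ifs with h
    · rfl
    · push Not at h
      exact le_antisymm (hf a ha hR) (h hR).2
  · simp [hR]

end Bounds

/-! ### Enumerations of the output of the m-Chase -/

/-- The list `bs` of tuples of `T` yields, by saturation, an output of the m-Chase. -/
structure Saturates (T : Set (Tup S)) (bs : List (Tup S)) : Prop where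
  mem : ∀ s ∈ bs, s ∈ T
  nodup : bs.Nodup
  inj : ∀ s ∈ bs, ∀ s' ∈ bs, values T s = values T s' → s = s'
  full : ∀ s ∈ T, keys S ⊆ s.sch → ∃ s' ∈ bs, values T s' = values T s

/-- Choices are functions of tuples, so the output of the chase is indexed by one representative
tuple for each m-tuple. -/
theorem exists_saturates {T : Set (Tup S)} (hT : Admissible T) {l : List (MTup S)}
    (hl : EnumeratesMChase T l) : ∃ bs, Saturates T bs ∧ l = bs.map (values T) := by
  obtain ⟨hnd, hreach, hfix⟩ := hl
  have hinv := (chaseInv_init hT).reflTransGen hreach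
  have hex : ∀ σ : MTup S, ∃ s, σ ∈ l → s ∈ T ∧ values T s = σ := by
    intro σ
    by_cases hσ : σ ∈ l
    · obtain ⟨s, hs, h⟩ := hinv.eq_values hT hfix hσ
      exact ⟨s, fun _ => ⟨hs, h.symm⟩⟩
    · exact ⟨fun _ => none, fun h => absurd h hσ⟩
  choose b hb using hex
  have hmap : l = (l.map b).map (values T) := by
    rw [List.map_map]
    conv_lhs => rw [← List.map_id l]
    exact List.map_congr_left fun σ hσ => (hb σ hσ).2.symm
  have hnd' : ((l.map b).map (values T)).Nodup := hmap ▸ hnd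
  refine ⟨l.map b, ⟨?_, hnd'.of_map, fun s hs s' hs' h => ?_, fun s hs hk => ?_⟩, hmap⟩
  · intro s hs
    obtain ⟨σ, hσ, rfl⟩ := List.mem_map.1 hs
    exact (hb σ hσ).1
  · exact List.inj_on_of_nodup_map hnd' hs hs' h
  · have hmem : values T s ∈ l := hinv.values_mem hT hfix hs hk
    exact ⟨_, List.mem_map_of_mem hmem, (hb _ hmem).2⟩

theorem values_eq_of_keys {T : Set (Tup S)} {s s' : Tup S} (h : ∀ A ∈ keys S, A ∈ s.sch)
    (h' : ∀ A ∈ keys S, s A = s' A) : (∀ A, Agree A s s') ∧ values T s = values T s' := by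
  have : ∀ A, Agree A s s' := fun A B hB =>
    ⟨h B (det_subset_keys A hB), h' B (det_subset_keys A hB)⟩
  exact ⟨this, funext fun A => values_congr T (this A)⟩

theorem key_mem_sch_of_values {T : Set (Tup S)} {s : Tup S} {A : Attr S} (hA : A ∈ keys S)
    (h : A ∈ (values T s).sch) : A ∈ s.sch := by
  obtain ⟨a, ha⟩ := h
  exact Tup.mem_sch.2 ⟨a, eq_of_mem_values_key hA ha⟩

namespace AnalyticQuery

variable {q : AnalyticQuery S} {T : Set (Tup S)} {part : Attr S → Cond S} {c : Tup S → Tup S}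
  {bs : List (Tup S)}

theorem Picks.sch_restrict (hc : IsChoice T c) {s : Tup S} (h : q.Picks T c s) :
    ((c s).restrict q.sch).sch = q.sch := by
  rw [Tup.sch_restrict, hc.sch_eq, Set.inter_eq_left]
  exact h.1

/-- The tuples selected in the repair that belongs to a choice. -/
theorem selected_eq (hT : Admissible T) (hbs : Saturates T bs) (hc : IsChoice T c)
    {R : Set (Tup S)} (hR : trueTuples R = chosen T c) :
    q.selected T R = {x | ∃ s ∈ bs, q.Picks T c s ∧ (c s).restrict q.sch = x} := by
  ext x
  constructor
  · rintro ⟨hx, hsch, hsat⟩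
    rw [hR] at hx
    obtain ⟨-, s, hs, hbel, hch⟩ := hx
    have hkx : keys S ⊆ x.sch := by rw [hsch]; exact keys_subset_sch
    have hk : keys S ⊆ s.sch := fun A hA => by
      obtain ⟨a, ha⟩ := Tup.mem_sch.1 (hkx hA)
      exact Tup.mem_sch.2 ⟨a, eq_of_mem_values_key hA (hbel A a ha)⟩
    -- A selected tuple has all keys, hence so does the tuple `s` above it, and the m-tuple of `s`
    -- is in the list. Its representative `s'` has the same keys as `s`.
    obtain ⟨s', hs', hv⟩ := hbs.full s hs hk
    have hag : ∀ A, Agree A s s' := (values_eq_of_keys (T := T) hk fun A hA => by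
      obtain ⟨a, ha⟩ := Tup.mem_sch.1 (hk hA)
      have := mem_values_self hT hs ha
      rw [← hv] at this
      rw [ha, eq_of_mem_values_key hA this]).1
    have hcs : ∀ A a, x A = some a → c s' A = some a := fun A a ha => by
      rw [← hc.coh _ _ _ (hag A)]
      -- With all keys present, every value of `x` is constrained, so `x` is a restriction of the
      -- chosen tuple.
      exact hch A ((det_subset_keys A).trans hkx) a ha
    have hxe : ∀ X ⊆ q.sch, (c s').restrict X = x.restrict X := fun X hX => by
      refine Tup.ext fun A a => ?_
      rw [Tup.restrict_eq_some, Tup.restrict_eq_some]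
      refine and_congr_right fun hA => ?_
      obtain ⟨b, hb⟩ := Tup.mem_sch.1 (hsch.symm ▸ hX hA : A ∈ x.sch)
      rw [hb, hcs A b hb]
    have hpick : q.Picks T c s' := by
      refine ⟨fun A hA => ?_, by rwa [hxe _ sch_subset_sch]⟩
      obtain ⟨b, hb⟩ := Tup.mem_sch.1 (hsch.symm ▸ hA : A ∈ x.sch)
      exact ⟨b, hv ▸ hbel A b hb⟩
    refine ⟨s', hs', hpick, ?_⟩
    rw [hxe _ subset_rfl]
    refine Tup.ext fun A a => ?_
    rw [Tup.restrict_eq_some]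
    exact ⟨fun h => h.2, fun h => ⟨hsch ▸ Tup.mem_sch.2 ⟨a, h⟩, h⟩⟩
  · rintro ⟨s, hs, hp, rfl⟩
    have hsch := hp.sch_restrict hc
    refine ⟨?_, hsch, ?_⟩
    · rw [hR]
      refine ⟨⟨_, hsch.symm ▸ meas_mem_sch⟩, s, hbs.mem s hs, fun A a h => ?_, fun A _ a h => ?_⟩
      · exact hc.mem s A a (Tup.restrict_eq_some.1 h).2
      · exact (Tup.restrict_eq_some.1 h).2
    · have : ((c s).restrict q.sch).restrict q.Γ.sch = (c s).restrict q.Γ.sch := by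
        refine Tup.ext fun A a => ?_
        simp only [Tup.restrict_eq_some]
        exact ⟨fun h => ⟨h.1, h.2.2⟩, fun h => ⟨h.1, sch_subset_sch h.1, h.2⟩⟩
      rw [this]
      exact hp.2

/-- Tuples of different m-tuples are distinguished by their keys. -/
theorem eq_of_restrict_eq (hT : Admissible T) (hbs : Saturates T bs) {c' : Tup S → Tup S}
    (hc : IsChoice T c) (hc' : IsChoice T c')
    {X : Set (Attr S)} (hX : keys S ⊆ X) {s s' : Tup S} (hs : s ∈ bs) (hs' : s' ∈ bs)
    (hp : q.sch ⊆ (values T s).sch) (h : (c s).restrict X = (c' s').restrict X) : s = s' := by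
  refine hbs.inj s hs s' hs' (values_eq_of_keys (fun A hA =>
    key_mem_sch_of_values hA (hp (keys_subset_sch hA))) fun A hA => ?_).2
  rw [← hc.key hT (hbs.mem s hs) hA, ← hc'.key hT (hbs.mem s' hs') hA,
    ← Tup.restrict_apply (t := c s) (hX hA), h, Tup.restrict_apply (hX hA)]

theorem answer_eq (hT : Admissible T) (hbs : Saturates T bs) (hc : IsChoice T c)
    {R : Set (Tup S)} (hR : trueTuples R = chosen T c) :
    q.answer T R = q.aggr.ofList (collect bs (q.Picks T c) (q.pickedVal c)) := by
  rw [answer, selected_eq hT hbs hc hR]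
  refine aggregate_eq_ofList _ _ hbs.nodup _ (fun s hs hp s' hs' _ h => ?_) _ fun s hs hp => ?_
  · exact eq_of_restrict_eq hT hbs hc hc keys_subset_sch hs hs' hp.1 h
  · rw [Tup.restrict_apply meas_mem_sch]
    exact hp.apply_meas hc

theorem selected_eq_empty_iff (hT : Admissible T) (hbs : Saturates T bs) (hc : IsChoice T c)
    {R : Set (Tup S)} (hR : trueTuples R = chosen T c) :
    q.selected T R = ∅ ↔ ∀ s ∈ bs, ¬ q.Picks T c s := by
  rw [selected_eq hT hbs hc hR, Set.eq_empty_iff_forall_notMem]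
  constructor
  · intro h s hs hp
    exact h _ ⟨s, hs, hp, rfl⟩
  · rintro h _ ⟨s, hs, hp, rfl⟩
    exact h s hs hp

/-! ### Validity and attainment of the computed bounds. -/

theorem csInf_mem_of_finite (X : Set ℝ) (h : X.Finite) (h' : X.Nonempty) : sInf X ∈ X :=
  h'.csInf_mem h

theorem csSup_mem_of_finite (X : Set ℝ) (h : X.Finite) (h' : X.Nonempty) : sSup X ∈ X :=
  h'.csSup_mem h

/-- Every repair selects a tuple if and only if some m-tuple is certain. -/
theorem forall_selected_nonempty_iff (hT : Admissible T) (hΓ : q.Γ.IndependentVia T part)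
    (hbs : Saturates T bs) :
    (∀ R, IsRepair T R → (q.selected T R).Nonempty) ↔
      ∃ s ∈ bs, q.Relevant T (values T s) ∧ q.Certain T (values T s) := by
  constructor
  · intro h
    -- The adverse choice selects certain m-tuples only. Which measure values it takes is immaterial
    -- here.
    obtain ⟨c, hc, hcP⟩ := exists_adverse_choice hT hΓ sInf csInf_mem_of_finite
    have := (h _ (isRepair_chosen hT hc)).ne_empty
    rw [Ne, selected_eq_empty_iff hT hbs hc (trueTuples_chosen hc)] at this
    push Not at this
    obtain ⟨s, hs, hp⟩ := this
    exact ⟨s, hs, hp.relevant hc, (hcP s (hp.relevant hc)).1.1 hp⟩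
  · rintro ⟨s, hs, hrel, hcert⟩ R hR
    obtain ⟨c, hc, hRc⟩ := exists_choice_of_isRepair hT hR
    rw [Set.nonempty_iff_ne_empty, Ne, selected_eq_empty_iff hT hbs hc hRc]
    exact fun h => h s hs (hcert.picks hc hrel)

/-- The lower bound that the algorithm computes. -/
noncomputable def lowerBound (q : AnalyticQuery S) (T : Set (Tup S)) (part : Attr S → Cond S)
    (bs : List (Tup S)) : Option ℝ :=
  q.aggr.ofList (collect bs (fun s => q.InLow T part (values T s))
      fun s => q.minVal T part (values T s))

/-- The upper bound that the algorithm computes. -/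
noncomputable def upperBound (q : AnalyticQuery S) (T : Set (Tup S)) (part : Attr S → Cond S)
    (bs : List (Tup S)) : Option ℝ :=
  q.aggr.ofList (collect bs (fun s => q.InHigh T part (values T s))
      fun s => q.maxVal T part (values T s))

theorem computeAggregate_change_iff : (q.computeAggregate T part (bs.map (values T))).change =
    true ↔ ∃ s ∈ bs, q.Relevant T (values T s) ∧ q.Certain T (values T s) := by
  rw [computeAggregate_change]
  simp only [List.mem_map, exists_exists_and_eq_and]

theorem algorithm_fst (h : ∃ s ∈ bs, q.Relevant T (values T s) ∧ q.Certain T (values T s)) :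
    (q.algorithm T part (bs.map (values T))).1 =
      Option.map₂ Prod.mk (q.lowerBound T part bs) (q.upperBound T part bs) := by
  unfold algorithm
  rw [if_pos (computeAggregate_change_iff.2 h)]
  simp only [computeAggregate_pmin, computeAggregate_pmax, collect_map]
  rfl

theorem algorithm_snd (h : ∃ s ∈ bs, q.Relevant T (values T s) ∧ q.Certain T (values T s)) :
    (q.algorithm T part (bs.map (values T))).2 =
      q.aggr.ofList (collect bs (fun s => q.InStrong T (values T s))
          fun s => sInf (values T s (Attr.meas q.M))) := by
  unfold algorithm
  rw [if_pos (computeAggregate_change_iff.2 h)]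
  simp only [computeAggregate_pans, collect_map]

theorem algorithm_of_not
    (h : ¬ ∃ s ∈ bs, q.Relevant T (values T s) ∧ q.Certain T (values T s)) :
    q.algorithm T part (bs.map (values T)) =
      match q.aggr with
      | .count => (some (0, 0), some 0)
      | _ => (none, none) := by
  unfold algorithm
  exact if_neg fun h' => h (computeAggregate_change_iff.1 h')

/-- The bounds that the algorithm computes hold in all repairs. -/
theorem exists_bounds (hT : Admissible T) (hΓ : q.Γ.IndependentVia T part)
    (hbs : Saturates T bs)
    (h : ∃ s ∈ bs, q.Relevant T (values T s) ∧ q.Certain T (values T s)) :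
    ∃ lo hi, q.lowerBound T part bs = some lo ∧ q.upperBound T part bs = some hi ∧
      ∀ R, IsRepair T R → ∃ d ∈ Set.Icc lo hi, q.answer T R = some d := by
  have key : ∀ c, IsChoice T c →
      ∃ lo hi d, q.lowerBound T part bs = some lo ∧ q.upperBound T part bs = some hi ∧
        q.aggr.ofList (collect bs (q.Picks T c) (q.pickedVal c)) = some d ∧
        d ∈ Set.Icc lo hi := by
    intro c hc
    obtain ⟨lo, d, h1, h2, h3⟩ := exists_ofList_low_le q.aggr
      (R := fun s => q.Relevant T (values T s)) (C := fun s => q.Certain T (values T s))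
      (J := q.Picks T c) (v := q.pickedVal c) (f := fun s => q.minVal T part (values T s))
      (fun s _ hr hcert => hcert.picks hc hr) (fun s _ hp => hp.relevant hc)
      (fun s _ hp => hp.minVal_le hT hΓ hc) h
    obtain ⟨hi, d', h1', h2', h3'⟩ := exists_le_ofList_high q.aggr
      (R := fun s => q.Relevant T (values T s)) (C := fun s => q.Certain T (values T s))
      (J := q.Picks T c) (v := q.pickedVal c) (f := fun s => q.maxVal T part (values T s))
      (fun s _ hr hcert => hcert.picks hc hr) (fun s _ hp => hp.relevant hc)
      (fun s _ hp => hp.le_maxVal hT hΓ hc) h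
    rw [h2] at h2'
    obtain rfl := Option.some.inj h2'
    exact ⟨lo, hi, d, h1, h1', h2, h3, h3'⟩
  obtain ⟨c, hc, -⟩ := exists_adverse_choice hT hΓ sInf csInf_mem_of_finite
  obtain ⟨lo, hi, -, hlo, hhi, -⟩ := key c hc
  refine ⟨lo, hi, hlo, hhi, fun R hR => ?_⟩
  obtain ⟨c, hc, hRc⟩ := exists_choice_of_isRepair hT hR
  obtain ⟨lo', hi', d, hlo', hhi', hd, hmem⟩ := key c hc
  rw [hlo] at hlo'
  rw [hhi] at hhi'
  obtain rfl := Option.some.inj hlo'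
  obtain rfl := Option.some.inj hhi'
  exact ⟨d, hmem, (answer_eq hT hbs hc hRc).trans hd⟩

theorem exists_answer_eq_of_choice (hT : Admissible T) (hbs : Saturates T bs)
    (hc : IsChoice T c) {p : Tup S → Prop} {f : Tup S → ℝ} (hp : ∀ s, q.Picks T c s ↔ p s)
    (hf : ∀ s, p s → q.pickedVal c s = f s) :
    ∃ R, IsRepair T R ∧ q.answer T R = q.aggr.ofList (collect bs p f) := by
  refine ⟨_, isRepair_chosen hT hc, ?_⟩
  rw [answer_eq hT hbs hc (trueTuples_chosen hc),
    collect_congr (fun s _ => hp s) fun s _ h => hf s ((hp s).1 h)]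

theorem exists_answer_favorable (hT : Admissible T) (hΓ : q.Γ.IndependentVia T part)
    (hbs : Saturates T bs) (e : Set ℝ → ℝ)
    (he : ∀ X : Set ℝ, X.Finite → X.Nonempty → e X ∈ X) :
    ∃ R, IsRepair T R ∧ q.answer T R = q.aggr.ofList
      (collect bs (fun s => q.Relevant T (values T s))
          fun s => e (q.candidates T part (values T s))) := by
  obtain ⟨c, hc, hcP⟩ := exists_favorable_choice hT hΓ e he
  exact exists_answer_eq_of_choice hT hbs hc (fun s => ⟨fun h => h.relevant hc,
    fun h => (hcP s h).1⟩) fun s h => (hcP s h).2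

theorem exists_answer_adverse (hT : Admissible T) (hΓ : q.Γ.IndependentVia T part)
    (hbs : Saturates T bs) (e : Set ℝ → ℝ)
    (he : ∀ X : Set ℝ, X.Finite → X.Nonempty → e X ∈ X) :
    ∃ R, IsRepair T R ∧ q.answer T R = q.aggr.ofList
      (collect bs (fun s => q.Relevant T (values T s) ∧ q.Certain T (values T s))
          fun s => e (q.candidates T part (values T s))) := by
  obtain ⟨c, hc, hcP⟩ := exists_adverse_choice hT hΓ e he
  exact exists_answer_eq_of_choice hT hbs hc (fun s => ⟨fun h => ⟨h.relevant hc,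
    (hcP s (h.relevant hc)).1.1 h⟩, fun h => (hcP s h.1).1.2 h.2⟩) fun s h => (hcP s h.1).2 h.2

theorem candidates_subset_adom {s : Tup S} :
    q.candidates T part (values T s) ⊆ adom T (Attr.meas q.M) := fun _ hv =>
  values_subset_adom T s _ (mem_candidates.1 hv).1

theorem minVal_nonneg (hΓ : q.Γ.IndependentVia T part)
    (hpos : ∀ m ∈ adom T (Attr.meas q.M), (0 : ℝ) ≤ m) {s : Tup S}
    (h : q.Relevant T (values T s)) : 0 ≤ q.minVal T part (values T s) :=
  le_csInf (h.candidates_nonempty hΓ) fun v hv => hpos v (candidates_subset_adom hv)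

theorem maxVal_nonneg (hpos : ∀ m ∈ adom T (Attr.meas q.M), (0 : ℝ) ≤ m) {s : Tup S} :
    0 ≤ q.maxVal T part (values T s) :=
  Real.sSup_nonneg fun v hv => hpos v (candidates_subset_adom hv)

/-- For `min`, every relevant m-tuple may lower the answer, so the favorable choice with least
values attains the bound. For the other operators only certain m-tuples enter, since for `sum` no
least value is negative, and the adverse choice with least values attains it. -/
theorem exists_answer_eq_lowerBound (hT : Admissible T) (hΓ : q.Γ.IndependentVia T part)
    (hbs : Saturates T bs)
    (hpos : q.aggr = .sum → ∀ m ∈ adom T (Attr.meas q.M), (0 : ℝ) ≤ m) :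
    ∃ R, IsRepair T R ∧ q.answer T R = q.lowerBound T part bs := by
  by_cases hmin : q.aggr = .min
  · obtain ⟨R, hR, h⟩ := exists_answer_favorable hT hΓ hbs sInf csInf_mem_of_finite
    refine ⟨R, hR, h.trans ?_⟩
    exact congrArg _ (collect_congr (fun s _ => by simp [InLow, hmin]) fun s _ _ => rfl)
  · obtain ⟨R, hR, h⟩ := exists_answer_adverse hT hΓ hbs sInf csInf_mem_of_finite
    refine ⟨R, hR, h.trans ?_⟩
    refine congrArg _ (collect_congr (fun s _ => ?_) fun s _ _ => rfl)
    refine and_congr_right fun hrel => ⟨Or.inl, ?_⟩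
    rintro (h | h | ⟨h, h'⟩)
    · exact h
    · exact absurd h hmin
    · exact absurd h' (not_lt.2 (minVal_nonneg hΓ (hpos h) hrel))

/-- A minimum is largest when only the certain m-tuples are selected, each with its greatest value;
for the other operators it is best to select everything relevant. For `sum`, the bound skips
m-tuples that are not certain and have greatest value zero, which does not alter the total. -/
theorem exists_answer_eq_upperBound (hT : Admissible T) (hΓ : q.Γ.IndependentVia T part)
    (hbs : Saturates T bs)
    (h : ∃ s ∈ bs, q.Relevant T (values T s) ∧ q.Certain T (values T s))
    (hpos : q.aggr = .sum → ∀ m ∈ adom T (Attr.meas q.M), (0 : ℝ) ≤ m) :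
    ∃ R, IsRepair T R ∧ q.answer T R = q.upperBound T part bs := by
  by_cases hmin : q.aggr = .min
  · obtain ⟨R, hR, h⟩ := exists_answer_adverse hT hΓ hbs sSup csSup_mem_of_finite
    refine ⟨R, hR, h.trans ?_⟩
    exact congrArg _ (collect_congr (fun s _ => by simp [InHigh, hmin]) fun s _ _ => rfl)
  · obtain ⟨R, hR, h'⟩ := exists_answer_favorable hT hΓ hbs sSup csSup_mem_of_finite
    refine ⟨R, hR, h'.trans ?_⟩
    by_cases hsum : q.aggr = .sum
    · have := ofList_sum_pos (bs := bs) (R := fun s => q.Relevant T (values T s))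
        (C := fun s => q.Certain T (values T s)) (f := fun s => q.maxVal T part (values T s))
        (fun s _ _ => maxVal_nonneg (hpos hsum)) h
      rw [upperBound, hsum]
      refine this.symm.trans ?_
      exact congrArg _ (collect_congr (fun s _ => by simp [InHigh, hsum]) fun s _ _ => rfl)
    · refine congrArg _ (collect_congr (fun s _ => ?_) fun s _ _ => rfl)
      have : q.aggr = .max ∨ q.aggr = .count := by
        cases hq : q.aggr <;> simp [hq] at hmin hsum ⊢
      refine ⟨fun h => ⟨h, Or.inr (this.imp id Or.inl)⟩, fun h => h.1⟩

theorem isConsistentAnswer_algorithm (hT : Admissible T) (hΓ : q.Γ.IndependentVia T part)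
    (hbs : Saturates T bs)
    (hpos : q.aggr = .sum → ∀ m ∈ adom T (Attr.meas q.M), (0 : ℝ) ≤ m) :
    q.IsConsistentAnswer T (q.algorithm T part (bs.map (values T))).1 := by
  refine ⟨?_, fun hne => ?_⟩
  · rintro ⟨R, hR, hemp⟩
    rw [algorithm_of_not fun h => ((forall_selected_nonempty_iff hT hΓ hbs).2 h R hR).ne_empty hemp]
    cases q.aggr <;> simp
  · have h := (forall_selected_nonempty_iff hT hΓ hbs).1 hne
    obtain ⟨lo, hi, hlo, hhi, hb⟩ := exists_bounds hT hΓ hbs h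
    refine ⟨lo, hi, ?_, hb, ?_, ?_⟩
    · rw [algorithm_fst h, hlo, hhi]; rfl
    · rw [← hlo]; exact exists_answer_eq_lowerBound hT hΓ hbs hpos
    · rw [← hhi]; exact exists_answer_eq_upperBound hT hΓ hbs h hpos

/-- For an operator other than `count`, an interval as consistent answer excludes repairs that
select nothing, so some m-tuple is certain. Both `glb` and `lub` are answers in repairs and so lie
between the computed bounds. -/
theorem algorithm_bounds (hT : Admissible T) (hΓ : q.Γ.IndependentVia T part)
    (hbs : Saturates T bs) (hq : q.aggr ≠ .count) {glb lub : ℝ}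
    (hcons : q.IsConsistentAnswer T (some (glb, lub))) :
    ∃ lo hi, (q.algorithm T part (bs.map (values T))).1 = some (lo, hi) ∧ lo ≤ glb ∧ lub ≤ hi := by
  have hne : ∀ R, IsRepair T R → (q.selected T R).Nonempty := fun R hR => by
    by_contra hemp
    have := (hcons.1 ⟨R, hR, Set.not_nonempty_iff_eq_empty.1 hemp⟩).1 hq
    simp at this
  obtain ⟨glb', lub', heq, -, ⟨R₁, hR₁, h₁⟩, R₂, hR₂, h₂⟩ := hcons.2 hne
  simp only [Option.some.injEq, Prod.mk.injEq] at heq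
  obtain ⟨rfl, rfl⟩ := heq
  have h := (forall_selected_nonempty_iff hT hΓ hbs).1 hne
  obtain ⟨lo, hi, hlo, hhi, hb⟩ := exists_bounds hT hΓ hbs h
  refine ⟨lo, hi, by rw [algorithm_fst h, hlo, hhi]; rfl, ?_, ?_⟩
  · obtain ⟨d, hd, hd'⟩ := hb R₁ hR₁
    rw [h₁] at hd'
    exact Option.some.inj hd' ▸ hd.1
  · obtain ⟨d, hd, hd'⟩ := hb R₂ hR₂
    rw [h₂] at hd'
    exact Option.some.inj hd' ▸ hd.2

/-! ### The strongly consistent answer -/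

theorem mem_ans_iff {R : Set (Tup S)} {x : Tup S} :
    x ∈ ans T (keys S ∪ {Attr.meas q.M}) q.Γ R ↔
      ∃ t ∈ q.selected T R, t.restrict (keys S ∪ {Attr.meas q.M}) = x := by
  constructor
  · rintro ⟨-, t, ht, hsch, hx, hsat⟩
    exact ⟨t, ⟨ht, hsch, hsat⟩, hx⟩
  · rintro ⟨t, ⟨ht, hsch, hsat⟩, rfl⟩
    refine ⟨?_, t, ht, hsch, rfl, hsat⟩
    rw [Tup.sch_restrict, hsch, Set.inter_eq_left]
    exact fun _ h => Or.inl h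

theorem mem_ans_iff_of_choice (hT : Admissible T) (hbs : Saturates T bs) (hc : IsChoice T c)
    {R : Set (Tup S)} (hR : trueTuples R = chosen T c) {x : Tup S} :
    x ∈ ans T (keys S ∪ {Attr.meas q.M}) q.Γ R ↔
      ∃ s ∈ bs, q.Picks T c s ∧ (c s).restrict (keys S ∪ {Attr.meas q.M}) = x := by
  have hres : ∀ t : Tup S, (t.restrict q.sch).restrict (keys S ∪ {Attr.meas q.M}) =
      t.restrict (keys S ∪ {Attr.meas q.M}) := by
    intro t
    refine Tup.ext fun A a => ?_
    simp only [Tup.restrict_eq_some]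
    exact ⟨fun h => ⟨h.1, h.2.2⟩, fun h => ⟨h.1, Or.inl h.1, h.2⟩⟩
  rw [mem_ans_iff, selected_eq hT hbs hc hR]
  constructor
  · rintro ⟨_, ⟨s, hs, hp, rfl⟩, rfl⟩
    exact ⟨s, hs, hp, (hres _).symm⟩
  · rintro ⟨s, hs, hp, rfl⟩
    exact ⟨_, ⟨s, hs, hp, rfl⟩, hres _⟩

/-- The choice `c` is arbitrary, because all choices agree on keys and on a measure with a single
value. That no other tuple is consistent is seen by testing two repairs, both adverse, one with
least and one with greatest measure values. -/
theorem consAns_eq (hT : Admissible T) (hΓ : q.Γ.IndependentVia T part)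
    (hbs : Saturates T bs) (hc : IsChoice T c) :
    consAns T (keys S ∪ {Attr.meas q.M}) q.Γ =
      {x | ∃ s ∈ bs, q.InStrong T (values T s) ∧
        (c s).restrict (keys S ∪ {Attr.meas q.M}) = x} := by
  have hM : Attr.meas q.M ∈ keys S ∪ {Attr.meas q.M} := Or.inr rfl
  have hsame : ∀ {c' : Tup S → Tup S} {s : Tup S}, IsChoice T c' → s ∈ bs →
      q.InStrong T (values T s) → (c' s).restrict (keys S ∪ {Attr.meas q.M}) =
        (c s).restrict (keys S ∪ {Attr.meas q.M}) := by
    intro c' s hc' hs hst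
    refine Tup.ext fun A a => ?_
    rw [Tup.restrict_eq_some, Tup.restrict_eq_some]
    refine and_congr_right ?_
    rintro (hA | rfl)
    · rw [hc'.key hT (hbs.mem s hs) hA, hc.key hT (hbs.mem s hs) hA]
    · obtain ⟨hrel, hcert, m, hm⟩ := hst
      have hval : ∀ {c : Tup S → Tup S}, IsChoice T c → c s (Attr.meas q.M) = some m := by
        intro c hc
        have h := (hcert.picks hc hrel).apply_meas hc
        have h' := hc.mem s _ _ h
        rw [hm] at h'
        rw [h, show q.pickedVal c s = m from h']
      rw [hval hc, hval hc']
  ext x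
  constructor
  · intro hx
    obtain ⟨c₁, hc₁, hP₁⟩ := exists_adverse_choice hT hΓ sInf csInf_mem_of_finite
    obtain ⟨c₂, hc₂, hP₂⟩ := exists_adverse_choice hT hΓ sSup csSup_mem_of_finite
    obtain ⟨s, hs, hp, hxs⟩ := (mem_ans_iff_of_choice hT hbs hc₁ (trueTuples_chosen hc₁)).1
      (hx _ (isRepair_chosen hT hc₁))
    obtain ⟨s', hs', hp', hxs'⟩ := (mem_ans_iff_of_choice hT hbs hc₂ (trueTuples_chosen hc₂)).1
      (hx _ (isRepair_chosen hT hc₂))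
    -- The keys of `x` identify the m-tuple, so both repairs obtain `x` from the same one. Its least
    -- and greatest measure values then coincide.
    obtain rfl := eq_of_restrict_eq (q := q) hT hbs hc₁ hc₂ Set.subset_union_left hs hs' hp.1
      (hxs.trans hxs'.symm)
    have hrel := hp.relevant hc₁
    have hcert := (hP₁ s hrel).1.1 hp
    have h₁ := (hP₁ s hrel).2 hcert
    have h₂ := (hP₂ s hrel).2 hcert
    have h : c₁ s (Attr.meas q.M) = c₂ s (Attr.meas q.M) := by
      rw [← Tup.restrict_apply (t := c₁ s) hM, hxs, ← hxs', Tup.restrict_apply hM]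
    rw [hp.apply_meas hc₁, hp'.apply_meas hc₂, h₁, h₂, candidates_of_certain hΓ hrel.1 hcert] at h
    have h := Option.some.inj h
    have hfin := values_finite hT s (Attr.meas q.M)
    have hst : q.InStrong T (values T s) := by
      refine ⟨hrel, hcert, sInf (values T s (Attr.meas q.M)), Set.Subset.antisymm ?_ ?_⟩
      · intro v hv
        exact le_antisymm (h ▸ le_csSup hfin.bddAbove hv) (csInf_le hfin.bddBelow hv)
      · exact Set.singleton_subset_iff.2 (csInf_mem_of_finite _ hfin (hrel.1 meas_mem_sch))
    exact ⟨s, hs, hst, (hsame hc₁ hs hst).symm.trans hxs⟩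
  · rintro ⟨s, hs, hst, rfl⟩ R hR
    obtain ⟨c', hc', hRc⟩ := exists_choice_of_isRepair hT hR
    exact (mem_ans_iff_of_choice hT hbs hc' hRc).2
      ⟨s, hs, hst.2.1.picks hc' hst.1, hsame hc' hs hst⟩

theorem strongAnswer_eq (hT : Admissible T) (hΓ : q.Γ.IndependentVia T part)
    (hbs : Saturates T bs) :
    q.strongAnswer T = q.aggr.ofList (collect bs (fun s => q.InStrong T (values T s))
        fun s => sInf (values T s (Attr.meas q.M))) := by
  obtain ⟨c, hc, -⟩ := exists_adverse_choice hT hΓ sInf csInf_mem_of_finite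
  rw [strongAnswer, consAns_eq hT hΓ hbs hc]
  refine aggregate_eq_ofList _ _ hbs.nodup _ (fun s hs hp s' hs' _ h => ?_) _ fun s hs hp => ?_
  · exact eq_of_restrict_eq hT hbs hc hc Set.subset_union_left hs hs' hp.1.1 h
  · obtain ⟨hrel, hcert, m, hm⟩ := hp
    rw [Tup.restrict_apply (Or.inr rfl)]
    have h := (hcert.picks hc hrel).apply_meas hc
    have h' := hc.mem s _ _ h
    rw [hm] at h'
    rw [h, show q.pickedVal c s = m from h', hm]
    exact congrArg some (csInf_singleton m).symm

theorem algorithm_snd_eq_strongAnswer (hT : Admissible T) (hΓ : q.Γ.IndependentVia T part)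
    (hbs : Saturates T bs) :
    (q.algorithm T part (bs.map (values T))).2 = q.strongAnswer T := by
  rw [strongAnswer_eq hT hΓ hbs]
  by_cases h : ∃ s ∈ bs, q.Relevant T (values T s) ∧ q.Certain T (values T s)
  · exact algorithm_snd h
  -- Without certain m-tuples nothing is strongly consistent, and the empty aggregate is the value
  -- returned by default.
  · rw [algorithm_of_not h, collect_eq_nil fun s hs hst => h ⟨s, hs, hst.1, hst.2.1⟩]
    cases q.aggr <;> simp [Aggr.ofList, procInit]

end AnalyticQuery

end StarDW

open StarDW
theorem proposition8 (S : StarSchema) (W : Warehouse S) (q : AnalyticQuery S)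
    (part : Attr S → Cond S) (hΓ : q.Γ.IndependentVia W.table part) :
    (∃ l, EnumeratesMChase W.table l) ∧
    ∀ l, EnumeratesMChase W.table l →
      ((q.aggr = .min ∨ q.aggr = .max ∨ q.aggr = .count) →
        q.IsConsistentAnswer W.table (q.algorithm W.table part l).1) ∧
      (q.aggr = .sum →
        (∀ glb lub : ℝ, q.IsConsistentAnswer W.table (some (glb, lub)) →
          ∃ min_ans max_ans : ℝ,
            (q.algorithm W.table part l).1 = some (min_ans, max_ans) ∧
            min_ans ≤ glb ∧ lub ≤ max_ans) ∧
        ((∀ m ∈ adom W.table (Attr.meas q.M), (0 : ℝ) ≤ m) →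
          q.IsConsistentAnswer W.table (q.algorithm W.table part l).1)) ∧
      (q.algorithm W.table part l).2 = q.strongAnswer W.table := by
  have hT := W.admissible
  refine ⟨exists_enumeratesMChase hT, fun l hl => ?_⟩
  obtain ⟨bs, hbs, rfl⟩ := exists_saturates hT hl
  refine ⟨fun hq => AnalyticQuery.isConsistentAnswer_algorithm hT hΓ hbs fun hs => ?_,
    fun hq => ⟨fun glb lub h => AnalyticQuery.algorithm_bounds hT hΓ hbs (by simp [hq]) h,
      fun hpos => AnalyticQuery.isConsistentAnswer_algorithm hT hΓ hbs fun _ => hpos⟩,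
    AnalyticQuery.algorithm_snd_eq_strongAnswer hT hΓ hbs⟩
  simp [hs] at hq
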